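/- **Setting.** Let $d\in\mathbb N$, and let $|\cdot|$ be the Euclidean norm on $\mathbb R^d$ and $B_r(\theta)$ the open ball. For $k=1,2$ let $L_k:\mathbb R^d\to\mathbb R$ be differentiable and bounded from below, $\underline{L_k}:=\inf L_k$, and let $M_{L_k},C_{L_k},M_{\nabla L_k},C_{\nabla L_k}>0$ be constants such that for all $\theta,\hat\theta\in\mathbb R^d$ $$|L_k(\theta)-L_k(\hat\theta)|\le M_{L_k}(|\theta|+|\hat\theta|)|\theta-\hat\theta|,\qquad L_k(\theta)-\underline{L_k}\le C_{L_k}(1+|\theta|^2),$$ $$|\nabla L_k(\theta)-\nabla L_k(\hat\theta)|\le M_{\nabla L_k}|\theta-\hat\theta|,\qquad |\nabla L_k(\theta)|\le C_{\nabla L_k}.$$ Suppose that $\theta_k^*\in\mathbb R^d$ satisfies $L_k(\theta_k^*)=\underline{L_k}$ and that there are $L_\infty^k,R_0^k,\eta_k>0$ and $\nu_k\in(0,\frac12]$ with $$|\theta-\theta_k^*|\le\tfrac1{\eta_k}\big(L_k(\theta)-\underline{L_k}\big)^{\nu_k}\ \text{ for }\theta\in B_{R_0^k}(\theta_k^*),\qquad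 L_\infty^k<L_k(\theta)-\underline{L_k}\ \text{ for }\theta\notin B_{R_0^k}(\theta_k^*).$$ Let $w_1,w_2>0$ with $w_1+w_2=1$. For $\alpha>0$ and a probability measure $\rho$ with finite first moment put $$m_{L_k}^\alpha[\rho]:=\frac{\int\theta e^{-\alpha L_k(\theta)}\,d\rho(\theta)}{\int e^{-\alpha L_k(\theta)}\,d\rho(\theta)}.$$ Let $\mathcal P_4(\mathbb R^d)$ be the set of Borel probability measures with finite fourth moment, with the $4$-Wasserstein distance. Given $\lambda_1,\lambda_2,\sigma_1,\sigma_2>0$, $T>0$ and $\rho_0^1,\rho_0^2\in\mathcal P_4(\mathbb R^d)$, a pair $\rho^1,\rho^2\in\mathcal C([0,T],\mathcal P_4(\mathbb R^d))$ is a *weak solution of the Fokker–Planck system on $[0,T]$* with initial conditions $\rho_0^1,\rho_0^2$ if, with $\rho_t:=w_1\rho_t^1+w_2\rho_t^2$, for $k=1,2$, every $\phi\in\mathcal C_c^\infty(\mathbb R^d)$ and every $t\in(0,T)$, $$\frac{d}{dt}\int\phi\,d\rho_t^k=\int\big(-\lambda_1(\theta-m_{L_k}^\alpha[\rho_t])-\lambda_2\nabla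 L_k(\theta)\big)\cdot\nabla\phi\,d\rho_t^k+\int\Big(\tfrac{\sigma_1^2}2|\theta-m_{L_k}^\alpha[\rho_t]|^2+\tfrac{\sigma_2^2}2|\nabla L_k(\theta)|^2\Big)\Delta\phi\,d\rho_t^k,$$ and $\rho_t^k\to\rho_0^k$ weakly as $t\to0$. **Theorem (concentration of the mean field around global minimizers).** Let $\rho_0^k\in\mathcal P_4(\mathbb R^d)$ satisfy $\rho_0^k(B_r(\theta_k^*))>0$ for all $r>0$ ($k=1,2$), and let $\mathcal V(\rho^k_t):=\frac12\int|\theta-\theta_k^*|^2\,d\rho^k_t(\theta)$. Let $\varepsilon\in(0,\mathcal V(\rho_0^1)+\mathcal V(\rho_0^2))$, $\tau\in(0,1)$, $M:=\max\{M_{\nabla L_1},M_{\nabla L_2}\}$, let $\lambda_1,\lambda_2,\sigma_1,\sigma_2>0$ satisfy $2\lambda_1>2\lambda_2M+d\sigma_1^2+d\sigma_2^2M^2$, and set $$T^*:=\frac1{(1-\tau)(2\lambda_1-2\lambda_2M-d\sigma_1^2-d\sigma_2^2M^2)}\log\frac{\mathcal V(\rho_0^1)+\mathcal V(\rho_0^2)}{\varepsilon}.$$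 Then there is $\alpha_0>0$, depending only on the data above, such that for every $\alpha>\alpha_0$ and every weak solution $\rho^1,\rho^2$ of the Fokker–Planck system on $[0,T^*]$ with initial conditions $\rho_0^1,\rho_0^2$: 1. $\min_{t\in[0,T^*]}\big(\mathcal V(\rho_t^1)+\mathcal V(\rho_t^2)\big)$ is attained and is at most $\varepsilon$; 2. for every $t\in[0,T^*]$ such that $\mathcal V(\rho_s^1)+\mathcal V(\rho_s^2)>\varepsilon$ for all $s\in[0,t)$, $$\mathcal V(\rho_t^1)+\mathcal V(\rho_t^2)\le\big(\mathcal V(\rho_0^1)+\mathcal V(\rho_0^2)\big)\exp\big(-(1-\tau)(2\lambda_1-2\lambda_2M-d\sigma_1^2-d\sigma_2^2M^2)\,t\big).$$ -/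

import Mathlib

open MeasureTheory Set Filter Topology
open scoped NNReal ENNReal ContDiff

noncomputable section

namespace FedCBO

/-- `ℝ^d` with the Euclidean norm. -/
abbrev E (d : ℕ) : Type := EuclideanSpace ℝ (Fin d)

/-- Regularity of a loss function, with explicit constants: `L` is bounded below, differentiable,
locally Lipschitz with linearly growing constant, at most quadratically growing, and has a
Lipschitz (constant `Mg`) and bounded (constant `Cg`) gradient. -/
structure LossRegular {d : ℕ} (L : E d → ℝ) (ML CL Mg Cg : ℝ) : Prop where
  bddBelow : BddBelow (range L)
  differentiable : Differentiable ℝ L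
  ML_pos : 0 < ML
  CL_pos : 0 < CL
  Mg_pos : 0 < Mg
  Cg_pos : 0 < Cg
  loc_lip : ∀ x y, |L x - L y| ≤ ML * (‖x‖ + ‖y‖) * ‖x - y‖
  quad_growth : ∀ x, L x - (⨅ z, L z) ≤ CL * (1 + ‖x‖ ^ 2)
  lip_grad : ∀ x y, ‖gradient L x - gradient L y‖ ≤ Mg * ‖x - y‖
  bdd_grad : ∀ x, ‖gradient L x‖ ≤ Cg

/-- `θs` is a global minimizer of the continuous function `L`, with local coercivity around `θs`
and a gap in the far field. -/
structure LossCoercive {d : ℕ} (L : E d → ℝ) (θs : E d) : Prop where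
  continuous : Continuous L
  isMin : L θs = ⨅ z, L z
  coercive : ∃ Linf R₀ η ν : ℝ, 0 < Linf ∧ 0 < R₀ ∧ 0 < η ∧ 0 < ν ∧ ν ≤ 1 / 2 ∧
    (∀ x ∈ Metric.ball θs R₀, ‖x - θs‖ ≤ 1 / η * (L x - ⨅ z, L z) ^ ν) ∧
    (∀ x ∉ Metric.ball θs R₀, Linf < L x - ⨅ z, L z)

/-- Membership in `𝒫₄(ℝ^d)`: finite fourth moment. -/
def MemP4 {d : ℕ} (μ : ProbabilityMeasure (E d)) : Prop :=
  Integrable (fun x : E d => ‖x‖ ^ 4) (μ : Measure (E d))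

/-- The `p`-Wasserstein distance, an infimum over all couplings `π` of `μ` and `ν`. -/
def wasserstein {d : ℕ} (p : ℝ) (μ ν : ProbabilityMeasure (E d)) : ℝ≥0∞ :=
  (⨅ π : {π : Measure (E d × E d) // π.map Prod.fst = (μ : Measure (E d)) ∧
      π.map Prod.snd = (ν : Measure (E d))}, ∫⁻ z, edist z.1 z.2 ^ p ∂π.1) ^ (1 / p)

/-- `ρ ∈ C([0,T], 𝒫₄(ℝ^d))`, where `𝒫₄(ℝ^d)` is endowed with the `4`-Wasserstein distance. -/
structure IsContinuousP4 {d : ℕ} (T : ℝ) (ρ : ℝ → ProbabilityMeasure (E d)) : Prop where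
  memP4 : ∀ t ∈ Icc 0 T, MemP4 (ρ t)
  continuous : ∀ t ∈ Icc 0 T,
    Tendsto (fun s => wasserstein 4 (ρ s) (ρ t)) (𝓝[Icc 0 T] t) (𝓝 0)

/-- The mixture `w₁ μ₁ + w₂ μ₂` of the two classes. -/
def mixture {d : ℕ} (w : Fin 2 → ℝ≥0) (μ : Fin 2 → ProbabilityMeasure (E d)) : Measure (E d) :=
  w 0 • (μ 0 : Measure (E d)) + w 1 • (μ 1 : Measure (E d))

/-- The consensus point `m_L^α[μ] = (∫ exp(-α L) dμ)⁻¹ ∫ θ exp(-α L(θ)) dμ(θ)`. -/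
def consensus {d : ℕ} (L : E d → ℝ) (α : ℝ) (μ : Measure (E d)) : E d :=
  (∫ x, Real.exp (-α * L x) ∂μ)⁻¹ • ∫ x, Real.exp (-α * L x) • x ∂μ

/-- The generator applied to a test function, when the consensus point is `m`:
`(-λ₁(θ - m) - λ₂∇L(θ))·∇φ(θ) + (σ₁²/2 |θ - m|² + σ₂²/2 |∇L(θ)|²) Δφ(θ)`. -/
def generator {d : ℕ} (L : E d → ℝ) (lam₁ lam₂ σ₁ σ₂ : ℝ) (m : E d) (φ : E d → ℝ) (x : E d) : ℝ :=
  inner ℝ (-(lam₁ • (x - m)) - lam₂ • gradient L x) (gradient φ x) +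
    (σ₁ ^ 2 / 2 * ‖x - m‖ ^ 2 + σ₂ ^ 2 / 2 * ‖gradient L x‖ ^ 2) * Laplacian.laplacian φ x

/-- `ρ = (ρ^1, ρ^2)` in `C([0,T], 𝒫₄(ℝ^d))` solves the coupled Fokker–Planck system weakly on
`[0,T]` with initial condition `ρ₀`. -/
structure IsWeakSolution {d : ℕ} (L : Fin 2 → E d → ℝ) (w : Fin 2 → ℝ≥0)
    (α lam₁ lam₂ σ₁ σ₂ T : ℝ) (ρ₀ : Fin 2 → ProbabilityMeasure (E d))
    (ρ : Fin 2 → ℝ → ProbabilityMeasure (E d)) : Prop where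
  continuous : ∀ k, IsContinuousP4 T (ρ k)
  hasDerivAt : ∀ k, ∀ φ : E d → ℝ, ContDiff ℝ ∞ φ → HasCompactSupport φ → ∀ t ∈ Ioo 0 T,
    HasDerivAt (fun s => ∫ x, φ x ∂(ρ k s : Measure (E d)))
      (∫ x, generator (L k) lam₁ lam₂ σ₁ σ₂
        (consensus (L k) α (mixture w fun j => ρ j t)) φ x ∂(ρ k t : Measure (E d))) t
  initial : ∀ k, Tendsto (ρ k) (𝓝[>] 0) (𝓝 (ρ₀ k))

/-- `𝒱(μ) = ½ ∫ |θ - θs|² dμ(θ)`. -/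
def variance {d : ℕ} (θs : E d) (μ : ProbabilityMeasure (E d)) : ℝ :=
  1 / 2 * ∫ x, ‖x - θs‖ ^ 2 ∂(μ : Measure (E d))

/-- `𝒱(μ^1) + 𝒱(μ^2)`, each taken around its own minimizer. -/
def totalVariance {d : ℕ} (θs : Fin 2 → E d) (μ : Fin 2 → ProbabilityMeasure (E d)) : ℝ :=
  variance (θs 0) (μ 0) + variance (θs 1) (μ 1)

/-- `2λ₁ - 2λ₂M - dσ₁² - dσ₂²M²`. -/
def rate (d : ℕ) (lam₁ lam₂ σ₁ σ₂ M : ℝ) : ℝ :=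
  2 * lam₁ - 2 * lam₂ * M - d * σ₁ ^ 2 - d * σ₂ ^ 2 * M ^ 2

/-- The time horizon `T* = log(V₀/ε) / ((1-τ)(2λ₁ - 2λ₂M - dσ₁² - dσ₂²M²))`. -/
def horizon (d : ℕ) (lam₁ lam₂ σ₁ σ₂ M τ V₀ ε : ℝ) : ℝ :=
  1 / ((1 - τ) * rate d lam₁ lam₂ σ₁ σ₂ M) * Real.log (V₀ / ε)

end FedCBO

end

/-! Apply the generator to `|x - θ|² / 2`, with consensus point `m` at distance at most `B` from the
minimizer `θ`. Since the gradient vanishes at `θ` and is `M`-Lipschitz, the quadratic terms combine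
to `-δ |x - θ|² / 2`, where `δ` is the rate, and Young's inequality turns the cross terms into an
error `K B²` at the price of a fraction `τ/2` of `δ`. While the total variance is at least `ε`, a
small `B` lets a second fraction `τ/2` absorb the error, and Grönwall gives decay at rate `(1 - τ)
δ`. Test functions must have compact support, so the square is truncated at scale `N`; the
truncation error is `O(1/N)` by the uniform fourth moments. This is `exists_generator_truncSq_le`
and `IsWeakSolution.totalVariance_le`.

It remains to keep both consensus points within `B`. The Laplace principle `norm_consensus_sub_le`
does so for large `α`, given a first-moment bound and a lower bound, uniform in `α`, for the mass
near each minimizer. The mass bound comes from testing against a bump `ψ` whose generator is at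
least `-p ψ` (`exists_generator_ballBump_ge`): near the edge of the ball the diffusion term
dominates the drift, even where the diffusion degenerates, because the squared drift is at most a
constant times the diffusion coefficient.

Both bounds presuppose that the consensus points are already close. `exists_consensus_close` breaks
the circle with a first-exit-time argument: closeness before a time implies strict closeness at that
time. All constants depend only on `B`, the horizon and the data, so `α₀` is chosen before the
solution. -/

namespace FedCBO

variable {d : ℕ}

/-! ### Moment bounds in `𝒫₄` -/

section Moments

theorem MemP4.integrable_sub_pow {μ : ProbabilityMeasure (E d)} (h : MemP4 μ) (c : E d) :
    Integrable (fun x : E d => ‖x - c‖ ^ 4) (μ : Measure (E d)) := by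
  refine ((h.const_mul 8).add (integrable_const (8 * ‖c‖ ^ 4))).mono' (by fun_prop) ?_
  refine ae_of_all _ fun x => ?_
  simp only [Pi.add_apply, norm_pow, norm_norm]
  calc ‖x - c‖ ^ 4 ≤ (‖x‖ + ‖c‖) ^ 4 := by gcongr; exact norm_sub_le _ _
    _ ≤ 8 * ‖x‖ ^ 4 + 8 * ‖c‖ ^ 4 := by
      nlinarith [sq_nonneg (‖x‖ - ‖c‖), sq_nonneg (‖x‖ ^ 2 - ‖c‖ ^ 2),
        mul_nonneg (sq_nonneg (‖x‖ - ‖c‖)) (sq_nonneg (‖x‖ + ‖c‖)),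
        mul_nonneg (sq_nonneg (‖x‖ - ‖c‖)) (sq_nonneg (‖x‖ - ‖c‖)),
        mul_nonneg (sq_nonneg (‖x‖ - ‖c‖)) (sq_nonneg ‖x‖),
        mul_nonneg (sq_nonneg (‖x‖ - ‖c‖)) (sq_nonneg ‖c‖)]

/-- A continuous function of at most quartic growth is integrable against `μ ∈ 𝒫₄`. -/
theorem MemP4.integrable_of_norm_le {F : Type*} [NormedAddCommGroup F]
    {μ : ProbabilityMeasure (E d)} (h : MemP4 μ) (c : E d) {f : E d → F} (hf : Continuous f)
    {K : ℝ} (hK : ∀ x, ‖f x‖ ≤ K * (1 + ‖x - c‖ ^ 4)) : Integrable f (μ : Measure (E d)) := by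
  refine (((integrable_const (1 : ℝ)).add (h.integrable_sub_pow c)).const_mul K).mono'
    hf.aestronglyMeasurable (ae_of_all _ fun x => ?_)
  simpa using hK x

theorem MemP4.integrable_sq {μ : ProbabilityMeasure (E d)} (h : MemP4 μ) (c : E d) :
    Integrable (fun x : E d => ‖x - c‖ ^ 2) (μ : Measure (E d)) := by
  refine h.integrable_of_norm_le c (K := 1) (by fun_prop) fun x => ?_
  simp only [norm_pow, norm_norm]
  nlinarith [sq_nonneg (‖x - c‖ ^ 2 - 1)]

theorem MemP4.integrable_norm_sub {μ : ProbabilityMeasure (E d)} (h : MemP4 μ) (c : E d) :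
    Integrable (fun x : E d => ‖x - c‖) (μ : Measure (E d)) := by
  refine h.integrable_of_norm_le c (K := 1) (by fun_prop) fun x => ?_
  simp only [norm_norm]
  nlinarith [sq_nonneg (‖x - c‖ ^ 2 - 1), sq_nonneg (‖x - c‖ - 1)]

end Moments

/-! ### Continuity of integrals and moment bounds along Wasserstein-continuous curves -/

section Wasserstein

variable {F : Type*} [NormedAddCommGroup F]

/-- Local Lipschitz continuity with a linearly growing constant. -/
def LinGrowthLipschitz (f : E d → F) : Prop :=
  ∃ K : ℝ, ∀ x y, ‖f x - f y‖ ≤ K * (1 + ‖x‖ + ‖y‖) * ‖x - y‖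

theorem LinGrowthLipschitz.exists_nonneg {f : E d → F} (hf : LinGrowthLipschitz f) :
    ∃ K : ℝ, 0 ≤ K ∧ ∀ x y, ‖f x - f y‖ ≤ K * (1 + ‖x‖ + ‖y‖) * ‖x - y‖ := by
  obtain ⟨K, hK⟩ := hf
  refine ⟨|K|, abs_nonneg _, fun x y => (hK x y).trans ?_⟩
  gcongr
  exact le_abs_self K

theorem LinGrowthLipschitz.continuous {f : E d → F} (hf : LinGrowthLipschitz f) :
    Continuous f := by
  obtain ⟨K, hK⟩ := hf
  refine continuous_iff_continuousAt.2 fun x => ?_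
  rw [ContinuousAt, tendsto_iff_norm_sub_tendsto_zero]
  refine squeeze_zero (fun _ => norm_nonneg _) (fun y => hK y x) ?_
  have : Continuous fun y : E d => K * (1 + ‖y‖ + ‖x‖) * ‖y - x‖ := by fun_prop
  simpa using this.tendsto x

theorem LinGrowthLipschitz.integrable {f : E d → F} (hf : LinGrowthLipschitz f)
    {μ : ProbabilityMeasure (E d)} (h : MemP4 μ) : Integrable f (μ : Measure (E d)) := by
  obtain ⟨K, hK0, hK⟩ := hf.exists_nonneg
  refine h.integrable_of_norm_le 0 (K := ‖f 0‖ + 2 * K) hf.continuous fun x => ?_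
  have h1 := hK x 0
  have h2 : ‖f x‖ ≤ ‖f 0‖ + ‖f x - f 0‖ := by
    simpa using norm_add_le (f 0) (f x - f 0)
  simp only [norm_zero, add_zero, sub_zero] at h1 ⊢
  have h3 : (1 + ‖x‖) * ‖x‖ ≤ 2 * (1 + ‖x‖ ^ 4) := by
    nlinarith [sq_nonneg (‖x‖ ^ 2 - 1), sq_nonneg (‖x‖ - 1)]
  have h4 : 0 ≤ ‖x‖ ^ 4 := by positivity
  nlinarith [mul_le_mul_of_nonneg_left h3 hK0, mul_nonneg (norm_nonneg (f 0)) h4]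

/-- A coupling whose transport cost is close to the Wasserstein distance. -/
theorem exists_coupling_of_tendsto {l : Filter ℝ} {ρ : ℝ → ProbabilityMeasure (E d)}
    {μ : ProbabilityMeasure (E d)} (h : Tendsto (fun s => wasserstein 4 (ρ s) μ) l (𝓝 0))
    {η : ℝ} (hη : 0 < η) :
    ∀ᶠ s in l, ∃ π : Measure (E d × E d), π.map Prod.fst = (ρ s : Measure (E d)) ∧
      π.map Prod.snd = (μ : Measure (E d)) ∧ IsProbabilityMeasure π ∧
      Integrable (fun z => ‖z.1 - z.2‖ ^ 4) π ∧ ∫ z, ‖z.1 - z.2‖ ^ 4 ∂π ≤ η := by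
  have hpos : (0 : ℝ≥0∞) < ENNReal.ofReal η ^ (1 / 4 : ℝ) :=
    ENNReal.rpow_pos (by simpa using hη) (by simp)
  filter_upwards [h.eventually (gt_mem_nhds hpos)] with s hs
  rw [wasserstein, ENNReal.rpow_lt_rpow_iff (by norm_num), iInf_lt_iff] at hs
  obtain ⟨⟨π, h1, h2⟩, hlt⟩ := hs
  have hcost : ∀ z : E d × E d, edist z.1 z.2 ^ (4 : ℝ) = ENNReal.ofReal (‖z.1 - z.2‖ ^ 4) := by
    intro z
    rw [edist_dist, dist_eq_norm, ENNReal.ofReal_pow (norm_nonneg _)]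
    norm_cast
  simp only [hcost] at hlt
  have hcont : Continuous fun z : E d × E d => ‖z.1 - z.2‖ ^ 4 := by fun_prop
  have hprob : IsProbabilityMeasure π := by
    constructor
    have : (π.map Prod.fst) univ = 1 := by rw [h1]; simp
    rwa [Measure.map_apply measurable_fst MeasurableSet.univ, preimage_univ] at this
  have hint : Integrable (fun z : E d × E d => ‖z.1 - z.2‖ ^ 4) π := by
    refine ⟨hcont.aestronglyMeasurable, ?_⟩
    rw [hasFiniteIntegral_iff_ofReal (ae_of_all _ fun z => by positivity)]
    exact hlt.trans ENNReal.ofReal_lt_top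
  refine ⟨π, h1, h2, hprob, hint, ?_⟩
  rw [← ENNReal.ofReal_le_ofReal_iff hη.le,
    ofReal_integral_eq_lintegral_ofReal hint (ae_of_all _ fun z => by positivity)]
  exact hlt.le

/-- Weighted Young inequalities. The exponents are arranged so that a transport cost of at most `a ^
4` leaves a total error of order `a`. -/
theorem add_mul_self_le_of_pos {a y D : ℝ} (ha : 0 < a) (ha1 : a ≤ 1) :
    (1 + 2 * y + D) * D ≤ a * ((1 + 2 * y) ^ 2 + 1) + D ^ 4 / a ^ 3 := by
  have h1 : (1 + 2 * y) * D ≤ a * (1 + 2 * y) ^ 2 + D ^ 2 / a / 4 := by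
    have : 0 ≤ (a * (1 + 2 * y) - D / 2) ^ 2 / a := by positivity
    have e : (a * (1 + 2 * y) - D / 2) ^ 2 / a =
        a * (1 + 2 * y) ^ 2 + D ^ 2 / a / 4 - (1 + 2 * y) * D := by field_simp; ring
    linarith
  have h2 : D * D ≤ D ^ 2 / a := by
    rw [le_div_iff₀ ha]; nlinarith [sq_nonneg D]
  have h3 : D ^ 2 / a ≤ a / 2 + D ^ 4 / a ^ 3 / 2 := by
    have : 0 ≤ (D ^ 2 - a ^ 2) ^ 2 / a ^ 3 := by positivity
    have e : (D ^ 2 - a ^ 2) ^ 2 / a ^ 3 = D ^ 4 / a ^ 3 + a - 2 * (D ^ 2 / a) := by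
      field_simp; ring
    linarith
  have h4 : 0 ≤ D ^ 2 / a := by positivity
  have h5 : 0 ≤ D ^ 4 / a ^ 3 := by positivity
  nlinarith

/-- Under a nearly optimal coupling the difference of the integrals is the integral of `f z.1 - f
z.2`. The growth factor is expressed through the fixed marginal `μ` alone, so its moment does not
depend on `s`. -/
theorem LinGrowthLipschitz.tendsto_integral [NormedSpace ℝ F] {f : E d → F}
    (hf : LinGrowthLipschitz f) {l : Filter ℝ} {ρ : ℝ → ProbabilityMeasure (E d)}
    {μ : ProbabilityMeasure (E d)} (hρ : ∀ᶠ s in l, MemP4 (ρ s)) (hμ : MemP4 μ)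
    (h : Tendsto (fun s => wasserstein 4 (ρ s) μ) l (𝓝 0)) :
    Tendsto (fun s => ∫ x, f x ∂(ρ s : Measure (E d))) l (𝓝 (∫ x, f x ∂(μ : Measure (E d)))) := by
  obtain ⟨K, hK0, hK⟩ := hf.exists_nonneg
  set A : ℝ := ∫ y, ((1 + 2 * ‖y‖) ^ 2 + 1) ∂(μ : Measure (E d)) with hA
  have hA0 : 0 ≤ A := integral_nonneg fun y => by positivity
  have hAint : Integrable (fun y : E d => (1 + 2 * ‖y‖) ^ 2 + 1) (μ : Measure (E d)) := by
    refine hμ.integrable_of_norm_le 0 (K := 10) (by fun_prop) fun x => ?_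
    rw [Real.norm_of_nonneg (by positivity), sub_zero]
    nlinarith [sq_nonneg (‖x‖ ^ 2 - 1), sq_nonneg (‖x‖ - 1)]
  rw [Metric.tendsto_nhds]
  intro e he
  obtain ⟨a, ha, ha1, hae⟩ : ∃ a : ℝ, 0 < a ∧ a ≤ 1 ∧ K * (a * (A + 1)) < e := by
    have : Tendsto (fun a : ℝ => K * (a * (A + 1))) (𝓝[>] 0) (𝓝 0) := by
      have hc : Continuous fun a : ℝ => K * (a * (A + 1)) := by fun_prop
      simpa using (hc.tendsto 0).mono_left nhdsWithin_le_nhds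
    have h1 : ∀ᶠ a : ℝ in 𝓝[>] 0, a ≤ 1 :=
      nhdsWithin_le_nhds (Iic_mem_nhds one_pos)
    obtain ⟨a, ha⟩ := ((this.eventually (gt_mem_nhds he)).and
      (h1.and self_mem_nhdsWithin)).exists
    exact ⟨a, ha.2.2, ha.2.1, ha.1⟩
  filter_upwards [hρ, exists_coupling_of_tendsto h (η := a ^ 4) (by positivity)] with s hs hπ
  obtain ⟨π, h1, h2, hprob, hint, hle⟩ := hπ
  have hfs := hf.integrable hs
  have hfμ := hf.integrable hμ
  rw [← h1] at hfs ⊢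
  have hfc := hf.continuous
  have e1 : Integrable (fun z : E d × E d => f z.1) π :=
    hfs.comp_measurable measurable_fst
  have e2 : Integrable (fun z : E d × E d => f z.2) π := by
    rw [← h2] at hfμ; exact hfμ.comp_measurable measurable_snd
  have e3 : Integrable (fun z : E d × E d => (1 + 2 * ‖z.2‖) ^ 2 + 1) π := by
    rw [← h2] at hAint; exact hAint.comp_measurable measurable_snd
  have e4 : ∫ z : E d × E d, ((1 + 2 * ‖z.2‖) ^ 2 + 1) ∂π = A := by
    rw [hA, ← h2, integral_map measurable_snd.aemeasurable
      (Continuous.aestronglyMeasurable (by fun_prop))]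
  have hdiff : (∫ x, f x ∂(π.map Prod.fst)) - ∫ x, f x ∂(μ : Measure (E d)) =
      ∫ z, (f z.1 - f z.2) ∂π := by
    rw [integral_sub e1 e2, ← h2, integral_map measurable_fst.aemeasurable
      hfs.aestronglyMeasurable, integral_map measurable_snd.aemeasurable
      (by rw [h2]; exact hfμ.aestronglyMeasurable)]
  rw [dist_eq_norm, hdiff]
  calc ‖∫ z, (f z.1 - f z.2) ∂π‖
      ≤ ∫ z, K * (a * ((1 + 2 * ‖z.2‖) ^ 2 + 1) + (1 / a ^ 3) * ‖z.1 - z.2‖ ^ 4) ∂π := by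
        refine norm_integral_le_of_norm_le
          (((e3.const_mul a).add (hint.const_mul (1 / a ^ 3))).const_mul K)
          (ae_of_all _ fun z => (hK z.1 z.2).trans ?_)
        rw [mul_assoc]
        refine mul_le_mul_of_nonneg_left ?_ hK0
        have := add_mul_self_le_of_pos (y := ‖z.2‖) (D := ‖z.1 - z.2‖) ha ha1
        have h5 : ‖z.1‖ ≤ ‖z.2‖ + ‖z.1 - z.2‖ := by
          simpa using norm_add_le z.2 (z.1 - z.2)
        have h6 : (1 + ‖z.1‖ + ‖z.2‖) * ‖z.1 - z.2‖ ≤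
            (1 + 2 * ‖z.2‖ + ‖z.1 - z.2‖) * ‖z.1 - z.2‖ := by
          refine mul_le_mul_of_nonneg_right ?_ (norm_nonneg _)
          linarith
        rw [one_div_mul_eq_div]
        exact h6.trans this
    _ = K * (a * A + (1 / a ^ 3) * ∫ z, ‖z.1 - z.2‖ ^ 4 ∂π) := by
        rw [integral_const_mul, integral_add (e3.const_mul a) (hint.const_mul _),
          integral_const_mul, integral_const_mul, e4]
    _ ≤ K * (a * A + (1 / a ^ 3) * a ^ 4) := by gcongr
    _ = K * (a * (A + 1)) := by field_simp
    _ < e := hae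

theorem LinGrowthLipschitz.continuousOn_integral [NormedSpace ℝ F] {f : E d → F}
    (hf : LinGrowthLipschitz f) {T : ℝ} {ρ : ℝ → ProbabilityMeasure (E d)}
    (hρ : IsContinuousP4 T ρ) :
    ContinuousOn (fun s => ∫ x, f x ∂(ρ s : Measure (E d))) (Icc 0 T) := fun t ht =>
  hf.tendsto_integral (eventually_of_mem self_mem_nhdsWithin hρ.memP4) (hρ.memP4 t ht)
    (hρ.continuous t ht)

/-- Fourth moments are bounded uniformly in time along a curve in `C([0,T], 𝒫₄)`. -/
theorem IsContinuousP4.exists_moment_bound {T : ℝ} {ρ : ℝ → ProbabilityMeasure (E d)}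
    (hρ : IsContinuousP4 T ρ) (c : E d) :
    ∃ C : ℝ, ∀ t ∈ Icc 0 T, ∫ x, ‖x - c‖ ^ 4 ∂(ρ t : Measure (E d)) ≤ C := by
  refine isCompact_Icc.induction_on (p := fun s => ∃ C : ℝ, ∀ t ∈ s,
    ∫ x, ‖x - c‖ ^ 4 ∂(ρ t : Measure (E d)) ≤ C) ⟨0, by simp⟩ ?_ ?_ ?_
  · rintro s t hst ⟨C, hC⟩
    exact ⟨C, fun u hu => hC u (hst hu)⟩
  · rintro s t ⟨C, hC⟩ ⟨C', hC'⟩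
    exact ⟨max C C', fun u hu => hu.elim (fun h => (hC u h).trans (le_max_left _ _))
      fun h => (hC' u h).trans (le_max_right _ _)⟩
  -- The fourth power grows too fast for `LinGrowthLipschitz`, but a local bound suffices by
  -- compactness: a coupling with `ρ t` of cost at most one and `(a + b)⁴ ≤ 8 (a⁴ + b⁴)` provide it.
  · intro t ht
    refine ⟨_, (exists_coupling_of_tendsto (hρ.continuous t ht) one_pos).and
      self_mem_nhdsWithin, 8 * (∫ x, ‖x - c‖ ^ 4 ∂(ρ t : Measure (E d))) + 8, ?_⟩
    rintro s ⟨⟨π, h1, h2, hprob, hint, hle⟩, hs⟩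
    have hs4 := (hρ.memP4 s hs).integrable_sub_pow c
    have ht4 := (hρ.memP4 t ht).integrable_sub_pow c
    rw [← h1] at hs4 ⊢
    rw [← h2] at ht4 ⊢
    have e1 : Integrable (fun z : E d × E d => ‖z.1 - c‖ ^ 4) π :=
      hs4.comp_measurable measurable_fst
    have e2 : Integrable (fun z : E d × E d => ‖z.2 - c‖ ^ 4) π :=
      ht4.comp_measurable measurable_snd
    rw [integral_map measurable_fst.aemeasurable hs4.aestronglyMeasurable,
      integral_map measurable_snd.aemeasurable ht4.aestronglyMeasurable]
    calc ∫ z, ‖z.1 - c‖ ^ 4 ∂π ≤ ∫ z, (8 * ‖z.2 - c‖ ^ 4 + 8 * ‖z.1 - z.2‖ ^ 4) ∂π := by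
          refine integral_mono e1 ((e2.const_mul 8).add (hint.const_mul 8)) fun z => ?_
          have h3 : ‖z.1 - c‖ ≤ ‖z.2 - c‖ + ‖z.1 - z.2‖ := by
            have := norm_add_le (z.2 - c) (z.1 - z.2)
            rwa [show z.2 - c + (z.1 - z.2) = z.1 - c by abel] at this
          have := (pow_le_pow_left₀ (norm_nonneg _) h3 4).trans
            (add_pow_le (norm_nonneg (z.2 - c)) (norm_nonneg (z.1 - z.2)) 4)
          norm_num at this
          simpa only [mul_add] using this
      _ = 8 * ∫ z, ‖z.2 - c‖ ^ 4 ∂π + 8 * ∫ z, ‖z.1 - z.2‖ ^ 4 ∂π := by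
          rw [integral_add (e2.const_mul 8) (hint.const_mul 8), integral_const_mul,
            integral_const_mul]
      _ ≤ _ := by linarith

theorem LinGrowthLipschitz.of_lipschitzWith {f : E d → F} {K : ℝ≥0} (hf : LipschitzWith K f) :
    LinGrowthLipschitz f := by
  refine ⟨K, fun x y => (hf.norm_sub_le x y).trans ?_⟩
  gcongr
  exact le_mul_of_one_le_right K.2 (by linarith [norm_nonneg x, norm_nonneg y])

theorem linGrowthLipschitz_norm_sub_sq (c : E d) :
    LinGrowthLipschitz fun x : E d => ‖x - c‖ ^ 2 := by
  refine ⟨2 + 2 * ‖c‖, fun x y => ?_⟩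
  have h1 : |‖x - c‖ - ‖y - c‖| ≤ ‖x - y‖ := by
    simpa using abs_norm_sub_norm_le (x - c) (y - c)
  rw [sq_sub_sq, norm_mul, Real.norm_eq_abs, Real.norm_eq_abs, abs_of_nonneg (by positivity)]
  gcongr
  nlinarith [norm_sub_le x c, norm_sub_le y c, norm_nonneg x, norm_nonneg y, norm_nonneg c,
    mul_nonneg (norm_nonneg c) (norm_nonneg x), mul_nonneg (norm_nonneg c) (norm_nonneg y)]

/-- A curve continuous in the Wasserstein distance starts at its weak limit. -/
theorem IsContinuousP4.eq_of_tendsto {T : ℝ} (hT : 0 < T) {ρ : ℝ → ProbabilityMeasure (E d)}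
    (hρ : IsContinuousP4 T ρ) {μ : ProbabilityMeasure (E d)}
    (h : Tendsto ρ (𝓝[>] 0) (𝓝 μ)) : ρ 0 = μ := by
  refine tendsto_nhds_unique (f := ρ) (l := 𝓝[>] 0) ?_ h
  -- Weak convergence may be tested on bounded Lipschitz functions, whose integrals are continuous
  -- along the curve; weak limits are unique.
  rw [tendsto_iff_forall_lipschitz_integral_tendsto]
  rintro f - ⟨K, hf⟩
  have := (LinGrowthLipschitz.of_lipschitzWith hf).continuousOn_integral hρ 0 ⟨le_rfl, hT.le⟩
  exact this.mono_left (nhdsWithin_le_of_mem (Icc_mem_nhdsGT hT))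

end Wasserstein

/-! ### Calculus of radial test functions -/

section Radial

variable {h h' h'' : ℝ → ℝ}

theorem hasFDerivAt_radial (hh : ∀ u, HasDerivAt h (h' u) u) (c x : E d) :
    HasFDerivAt (fun y : E d => h (‖y - c‖ ^ 2))
      ((2 * h' (‖x - c‖ ^ 2)) • innerSL ℝ (x - c)) x := by
  have h1 : HasFDerivAt (fun y : E d => ‖y - c‖ ^ 2) (2 • innerSL ℝ (x - c)) x := by
    have := ((hasFDerivAt_id x).sub_const c).norm_sq
    simpa using this
  have := (hh (‖x - c‖ ^ 2)).comp_hasFDerivAt x h1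
  refine this.congr_fderiv ?_
  ext y
  simp only [two_smul, smul_apply, add_apply, smul_eq_mul]
  ring

theorem gradient_radial (hh : ∀ u, HasDerivAt h (h' u) u) (c x : E d) :
    gradient (fun y : E d => h (‖y - c‖ ^ 2)) x = (2 * h' (‖x - c‖ ^ 2)) • (x - c) := by
  apply HasGradientAt.gradient
  rw [hasGradientAt_iff_hasFDerivAt]
  refine (hasFDerivAt_radial hh c x).congr_fderiv ?_
  ext y
  simp

/-- The Hessian is `2 h' I + 4 h'' (x - c) ⊗ (x - c)`; take its trace in the standard basis. -/
theorem laplacian_radial (hh : ∀ u, HasDerivAt h (h' u) u) (hh' : ∀ u, HasDerivAt h' (h'' u) u)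
    (c x : E d) :
    Laplacian.laplacian (fun y : E d => h (‖y - c‖ ^ 2)) x =
      4 * h'' (‖x - c‖ ^ 2) * ‖x - c‖ ^ 2 + 2 * d * h' (‖x - c‖ ^ 2) := by
  have e1 : fderiv ℝ (fun y : E d => h (‖y - c‖ ^ 2)) =
      fun y => (2 * h' (‖y - c‖ ^ 2)) • innerSL ℝ (y - c) :=
    funext fun y => (hasFDerivAt_radial hh c y).fderiv
  have h1 : HasFDerivAt (fun y : E d => 2 * h' (‖y - c‖ ^ 2))
      ((2 : ℝ) • (2 * h'' (‖x - c‖ ^ 2)) • innerSL ℝ (x - c)) x :=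
    (hasFDerivAt_radial hh' c x).const_mul 2
  have h2 : HasFDerivAt (fun y : E d => innerSL ℝ (y - c)) (innerSL ℝ) x :=
    (innerSL ℝ (E := E d)).hasFDerivAt.comp x ((hasFDerivAt_id x).sub_const c)
  have h3 := (h1.smul h2).fderiv
  rw [InnerProductSpace.laplacian_eq_iteratedFDeriv_orthonormalBasis _
    (EuclideanSpace.basisFun (Fin d) ℝ)]
  simp only [iteratedFDeriv_two_apply, e1]
  have h4 : ∀ i : Fin d,
      (fderiv ℝ (fun y : E d => (2 * h' (‖y - c‖ ^ 2)) • innerSL ℝ (y - c)) x)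
        (![EuclideanSpace.basisFun (Fin d) ℝ i, EuclideanSpace.basisFun (Fin d) ℝ i] 0)
        (![EuclideanSpace.basisFun (Fin d) ℝ i, EuclideanSpace.basisFun (Fin d) ℝ i] 1) =
      2 * h' (‖x - c‖ ^ 2) + 4 * h'' (‖x - c‖ ^ 2) * ((x - c) i) ^ 2 := by
    intro i
    have h5 : innerSL ℝ (EuclideanSpace.single i (1 : ℝ) : E d) (EuclideanSpace.single i 1) = 1 := by
      rw [innerSL_apply_apply]; simp
    rw [show (fun y : E d => (2 * h' (‖y - c‖ ^ 2)) • innerSL ℝ (y - c)) =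
      (fun y : E d => 2 * h' (‖y - c‖ ^ 2)) • fun y => innerSL ℝ (y - c) from rfl, h3]
    simp [EuclideanSpace.inner_single_right, h5]
    ring
  rw [Finset.sum_congr rfl fun i _ => h4 i, Finset.sum_add_distrib, ← Finset.mul_sum,
    ← Finset.mul_sum, ← EuclideanSpace.real_norm_sq_eq, Finset.sum_const, Finset.card_univ, Fintype.card_fin,
    nsmul_eq_mul]
  ring

/-- The generator applied to the radial function `x ↦ h(|x - c|²)`. -/
theorem generator_radial (hh : ∀ u, HasDerivAt h (h' u) u) (hh' : ∀ u, HasDerivAt h' (h'' u) u)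
    (L : E d → ℝ) (lam₁ lam₂ σ₁ σ₂ : ℝ) (m c x : E d) :
    generator L lam₁ lam₂ σ₁ σ₂ m (fun y => h (‖y - c‖ ^ 2)) x =
      2 * h' (‖x - c‖ ^ 2) * inner ℝ (-(lam₁ • (x - m)) - lam₂ • gradient L x) (x - c) +
      (σ₁ ^ 2 / 2 * ‖x - m‖ ^ 2 + σ₂ ^ 2 / 2 * ‖gradient L x‖ ^ 2) *
        (4 * h'' (‖x - c‖ ^ 2) * ‖x - c‖ ^ 2 + 2 * d * h' (‖x - c‖ ^ 2)) := by
  rw [generator, gradient_radial hh, laplacian_radial hh hh', inner_smul_right]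

theorem contDiff_radial (hh : ContDiff ℝ ∞ h) (c : E d) :
    ContDiff ℝ ∞ fun y : E d => h (‖y - c‖ ^ 2) :=
  hh.comp ((contDiff_id.sub contDiff_const).norm_sq ℝ)

theorem hasCompactSupport_radial {R : ℝ} (hR : ∀ u, R ^ 2 ≤ u → h u = 0) (hR0 : 0 ≤ R)
    (c : E d) : HasCompactSupport fun y : E d => h (‖y - c‖ ^ 2) := by
  refine HasCompactSupport.intro (isCompact_closedBall c R) fun x hx => hR _ ?_
  rw [Metric.mem_closedBall, dist_eq_norm, not_le] at hx
  exact pow_le_pow_left₀ hR0 hx.le 2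

theorem linGrowthLipschitz_of_hasCompactSupport {φ : E d → ℝ} (h1 : ContDiff ℝ ∞ φ)
    (h2 : HasCompactSupport φ) : LinGrowthLipschitz φ := by
  obtain ⟨K, hK⟩ := h1.lipschitzWith_of_hasCompactSupport h2 (by simp)
  exact .of_lipschitzWith hK

end Radial

/-! ### Regularity of the Gibbs weight, continuity of the consensus point, Laplace principle -/

section Loss

variable {L : E d → ℝ} {ML CL Mg Cg : ℝ}

theorem LossRegular.continuous_gradient (hL : LossRegular L ML CL Mg Cg) :
    Continuous (gradient L) :=
  (LipschitzWith.of_dist_le_mul (K := ⟨Mg, hL.Mg_pos.le⟩) fun x y => by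
    rw [dist_eq_norm, dist_eq_norm]; exact hL.lip_grad x y).continuous

theorem LossRegular.iInf_le (hL : LossRegular L ML CL Mg Cg) (x : E d) : ⨅ z, L z ≤ L x :=
  ciInf_le hL.bddBelow x

theorem LossRegular.gradient_eq_zero (hL : LossRegular L ML CL Mg Cg) {θ : E d}
    (hθ : L θ = ⨅ z, L z) : gradient L θ = 0 := by
  have : IsLocalMin L θ := Eventually.of_forall fun x => hθ ▸ hL.iInf_le x
  simp [gradient, this.fderiv_eq_zero]

theorem LossRegular.norm_gradient_le (hL : LossRegular L ML CL Mg Cg) {θ : E d}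
    (hθ : L θ = ⨅ z, L z) (x : E d) : ‖gradient L x‖ ≤ Mg * ‖x - θ‖ := by
  simpa [hL.gradient_eq_zero hθ] using hL.lip_grad x θ

/-- The mean value inequality with the bounded gradient. This global Lipschitz bound makes the Gibbs
weight Lipschitz and its product with `x` Lipschitz of linear growth, as continuity in time of the
consensus point requires. -/
theorem LossRegular.abs_sub_le (hL : LossRegular L ML CL Mg Cg) (x y : E d) :
    |L x - L y| ≤ Cg * ‖x - y‖ := by
  refine convex_univ.norm_image_sub_le_of_norm_fderiv_le (𝕜 := ℝ)
    (fun z _ => hL.differentiable z) (fun z _ => ?_) (mem_univ y) (mem_univ x)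
  rw [← toDual_gradient, LinearIsometryEquiv.norm_map]
  exact hL.bdd_grad z

theorem abs_exp_sub_exp_le {a b M : ℝ} (ha : a ≤ M) (hb : b ≤ M) :
    |Real.exp a - Real.exp b| ≤ Real.exp M * |a - b| := by
  wlog hab : b ≤ a generalizing a b
  · rw [abs_sub_comm, abs_sub_comm a]
    exact this hb ha (le_of_not_ge hab)
  rw [abs_of_nonneg (by simpa using hab), abs_of_nonneg (by linarith)]
  have h1 : 1 - (a - b) ≤ Real.exp (b - a) := by
    have := Real.add_one_le_exp (b - a); linarith
  have h2 : Real.exp b = Real.exp a * Real.exp (b - a) := by rw [← Real.exp_add]; ring_nf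
  have h3 : Real.exp a ≤ Real.exp M := Real.exp_le_exp.2 ha
  nlinarith [Real.exp_pos a]

theorem LossRegular.exp_le (hL : LossRegular L ML CL Mg Cg) {α : ℝ} (hα : 0 ≤ α) (x : E d) :
    -α * L x ≤ -α * ⨅ z, L z :=
  mul_le_mul_of_nonpos_left (hL.iInf_le x) (by linarith)

theorem LossRegular.abs_exp_sub_le (hL : LossRegular L ML CL Mg Cg) {α : ℝ} (hα : 0 ≤ α)
    (x y : E d) : |Real.exp (-α * L x) - Real.exp (-α * L y)| ≤
      Real.exp (-α * ⨅ z, L z) * (α * Cg) * ‖x - y‖ := by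
  refine (abs_exp_sub_exp_le (hL.exp_le hα x) (hL.exp_le hα y)).trans ?_
  rw [← mul_sub, abs_mul, abs_neg, abs_of_nonneg hα, mul_assoc, mul_assoc]
  gcongr
  exact hL.abs_sub_le x y

theorem LossRegular.linGrowthLipschitz_exp (hL : LossRegular L ML CL Mg Cg) {α : ℝ}
    (hα : 0 ≤ α) : LinGrowthLipschitz fun x => Real.exp (-α * L x) := by
  refine ⟨Real.exp (-α * ⨅ z, L z) * (α * Cg), fun x y => (hL.abs_exp_sub_le hα x y).trans ?_⟩
  have := hL.Cg_pos
  refine mul_le_mul_of_nonneg_right ?_ (norm_nonneg _)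
  exact le_mul_of_one_le_right (by positivity) (by linarith [norm_nonneg x, norm_nonneg y])

theorem LossRegular.linGrowthLipschitz_exp_smul (hL : LossRegular L ML CL Mg Cg) {α : ℝ}
    (hα : 0 ≤ α) : LinGrowthLipschitz fun x => Real.exp (-α * L x) • x := by
  have hC := hL.Cg_pos
  set S := Real.exp (-α * ⨅ z, L z) with hS
  refine ⟨S * (1 + α * Cg), fun x y => ?_⟩
  have e : Real.exp (-α * L x) • x - Real.exp (-α * L y) • y =
      Real.exp (-α * L x) • (x - y) + (Real.exp (-α * L x) - Real.exp (-α * L y)) • y := by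
    rw [smul_sub, sub_smul]; abel
  rw [e]
  refine (norm_add_le _ _).trans ?_
  rw [norm_smul, norm_smul, Real.norm_eq_abs, Real.norm_eq_abs, abs_of_pos (Real.exp_pos _)]
  have h1 : Real.exp (-α * L x) ≤ S := Real.exp_le_exp.2 (hL.exp_le hα x)
  have h2 := hL.abs_exp_sub_le hα x y
  have hS0 : 0 < S := Real.exp_pos _
  calc _ ≤ S * ‖x - y‖ + S * (α * Cg) * ‖x - y‖ * ‖y‖ := by gcongr
    _ = S * (1 + α * Cg * ‖y‖) * ‖x - y‖ := by ring
    _ ≤ _ := by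
      gcongr ?_ * _
      rw [mul_assoc S (1 + α * Cg)]
      refine mul_le_mul_of_nonneg_left ?_ hS0.le
      have : 0 ≤ α * Cg := by positivity
      nlinarith [norm_nonneg x, norm_nonneg y, mul_nonneg this (norm_nonneg x)]

theorem integrable_mixture {F : Type*} [NormedAddCommGroup F] {w : Fin 2 → ℝ≥0}
    {μ : Fin 2 → ProbabilityMeasure (E d)} {f : E d → F}
    (hf : ∀ k, Integrable f (μ k : Measure (E d))) : Integrable f (mixture w μ) := by
  refine integrable_add_measure.2 ⟨?_, ?_⟩
  · exact (hf 0).smul_measure_nnreal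
  · exact (hf 1).smul_measure_nnreal

theorem integral_mixture {F : Type*} [NormedAddCommGroup F] [NormedSpace ℝ F] {w : Fin 2 → ℝ≥0}
    {μ : Fin 2 → ProbabilityMeasure (E d)} {f : E d → F}
    (hf : ∀ k, Integrable f (μ k : Measure (E d))) : ∫ x, f x ∂(mixture w μ) =
      (w 0 : ℝ) • ∫ x, f x ∂(μ 0 : Measure (E d)) + (w 1 : ℝ) • ∫ x, f x ∂(μ 1 : Measure (E d)) := by
  rw [mixture, integral_add_measure (hf 0).smul_measure_nnreal (hf 1).smul_measure_nnreal,
    integral_smul_nnreal_measure, integral_smul_nnreal_measure]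
  rfl

theorem isProbabilityMeasure_mixture {w : Fin 2 → ℝ≥0} (hw : w 0 + w 1 = 1)
    (μ : Fin 2 → ProbabilityMeasure (E d)) : IsProbabilityMeasure (mixture w μ) := by
  constructor
  simp only [mixture, Measure.add_apply, Measure.smul_apply, measure_univ]
  simpa [ENNReal.smul_def] using (by exact_mod_cast hw : (w 0 : ℝ≥0∞) + w 1 = 1)

/-- The consensus point depends continuously on time. -/
theorem LossRegular.continuousOn_consensus (hL : LossRegular L ML CL Mg Cg) {α : ℝ}
    (hα : 0 ≤ α) {w : Fin 2 → ℝ≥0} (hw : w 0 + w 1 = 1) {T : ℝ}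
    {ρ : Fin 2 → ℝ → ProbabilityMeasure (E d)} (hρ : ∀ k, IsContinuousP4 T (ρ k)) :
    ContinuousOn (fun t => consensus L α (mixture w fun j => ρ j t)) (Icc 0 T) := by
  have key : ∀ {F : Type} [NormedAddCommGroup F] [NormedSpace ℝ F] {f : E d → F},
      LinGrowthLipschitz f →
      ContinuousOn (fun t => ∫ x, f x ∂(mixture w fun j => ρ j t)) (Icc 0 T) := by
    intro F _ _ f hf
    refine ContinuousOn.congr (f := fun t => (w 0 : ℝ) • ∫ x, f x ∂(ρ 0 t : Measure (E d)) +
      (w 1 : ℝ) • ∫ x, f x ∂(ρ 1 t : Measure (E d))) ?_ fun t ht =>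
        integral_mixture fun k => hf.integrable ((hρ k).memP4 t ht)
    exact ((hf.continuousOn_integral (hρ 0)).const_smul _).add
      ((hf.continuousOn_integral (hρ 1)).const_smul _)
  refine ((key (hL.linGrowthLipschitz_exp hα)).inv₀ fun t ht => ?_).smul
    (key (hL.linGrowthLipschitz_exp_smul hα))
  have := isProbabilityMeasure_mixture hw fun j => ρ j t
  exact (integral_exp_pos (integrable_mixture fun k =>
    (hL.linGrowthLipschitz_exp hα).integrable ((hρ k).memP4 t ht))).ne'

/-- Quantitative Laplace principle. -/
theorem norm_consensus_sub_le {α q r R : ℝ}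
    (hα : 0 ≤ α) {θ : E d} {μ : Measure (E d)} [IsProbabilityMeasure μ]
    (hR : ∀ x, L x - (⨅ z, L z) ≤ 2 * q → ‖x - θ‖ ≤ R)
    (hr : ∀ x ∈ Metric.ball θ r, L x - (⨅ z, L z) ≤ q) (hpos : 0 < μ.real (Metric.ball θ r))
    (hint : Integrable (fun x => ‖x - θ‖) μ)
    (hexp : Integrable (fun x => Real.exp (-α * L x)) μ)
    (hexp' : Integrable (fun x => Real.exp (-α * L x) • x) μ) (hR0 : 0 ≤ R) :
    ‖consensus L α μ - θ‖ ≤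
      R + Real.exp (-(α * q)) / μ.real (Metric.ball θ r) * ∫ x, ‖x - θ‖ ∂μ := by
  set I := ⨅ z, L z
  set Z := ∫ x, Real.exp (-α * L x) ∂μ with hZ
  set p := μ.real (Metric.ball θ r) with hp
  set J := ∫ x, ‖x - θ‖ ∂μ with hJ
  have hJ0 : 0 ≤ J := integral_nonneg fun x => norm_nonneg _
  have hZpos : 0 < Z := integral_exp_pos hexp
  -- Only the mass of the small ball, where `L ≤ I + q`, is kept in the normalization.
  have hZ1 : Real.exp (-α * (I + q)) * p ≤ Z := by
    calc Real.exp (-α * (I + q)) * p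
        = ∫ x in Metric.ball θ r, Real.exp (-α * (I + q)) ∂μ := by
          rw [setIntegral_const, smul_eq_mul, mul_comm]
      _ ≤ ∫ x in Metric.ball θ r, Real.exp (-α * L x) ∂μ := by
          refine setIntegral_mono_on (integrable_const _).integrableOn hexp.integrableOn
            Metric.isOpen_ball.measurableSet fun x hx => Real.exp_le_exp.2 ?_
          exact mul_le_mul_of_nonpos_left (by linarith [hr x hx]) (by linarith)
      _ ≤ Z := setIntegral_le_integral hexp (ae_of_all _ fun x => (Real.exp_pos _).le)
  have e : consensus L α μ - θ = Z⁻¹ • ∫ x, Real.exp (-α * L x) • (x - θ) ∂μ := by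
    have h1 : ∫ x, Real.exp (-α * L x) • (x - θ) ∂μ =
        (∫ x, Real.exp (-α * L x) • x ∂μ) - Z • θ := by
      simp only [smul_sub]
      rw [integral_sub hexp' (hexp.smul_const θ), integral_smul_const]
    rw [h1, smul_sub, inv_smul_smul₀ hZpos.ne', consensus]
  have hnum : ‖∫ x, Real.exp (-α * L x) • (x - θ) ∂μ‖ ≤
      R * Z + Real.exp (-α * (I + 2 * q)) * J := by
    rw [hZ, hJ, ← integral_const_mul, ← integral_const_mul,
      ← integral_add (hexp.const_mul R) (hint.const_mul _)]
    refine norm_integral_le_of_norm_le ((hexp.const_mul R).add (hint.const_mul _))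
      (ae_of_all _ fun x => ?_)
    rw [norm_smul, Real.norm_of_nonneg (Real.exp_pos _).le]
    have h0 := Real.exp_pos (-α * L x)
    have h0' := Real.exp_pos (-α * (I + 2 * q))
    -- Below level `2q` the point itself is within `R`; above it the weight is at most `exp (-α (I +
    -- 2q))`, smaller than the lower bound for `Z` by a factor of order `exp (-α q)`.
    rcases le_or_gt (L x - I) (2 * q) with hx | hx
    · have := mul_le_mul_of_nonneg_left (hR x hx) h0.le
      have := mul_nonneg h0'.le (norm_nonneg (x - θ))
      linarith
    · have h1 : Real.exp (-α * L x) ≤ Real.exp (-α * (I + 2 * q)) :=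
        Real.exp_le_exp.2 (mul_le_mul_of_nonpos_left (by linarith) (by linarith))
      have := mul_le_mul_of_nonneg_right h1 (norm_nonneg (x - θ))
      have := mul_nonneg hR0 h0.le
      linarith
  rw [e, norm_smul, norm_inv, Real.norm_of_nonneg hZpos.le, inv_mul_le_iff₀ hZpos]
  refine hnum.trans ?_
  have h2 : Real.exp (-α * (I + 2 * q)) * J ≤ Z * (Real.exp (-(α * q)) / p * J) := by
    have h3 : Real.exp (-α * (I + 2 * q)) = Real.exp (-α * (I + q)) * p *
        (Real.exp (-(α * q)) / p) := by
      rw [mul_assoc, mul_div_cancel₀ _ hpos.ne', ← Real.exp_add]; ring_nf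
    rw [h3, ← mul_assoc]
    gcongr
  linarith

theorem LossRegular.continuous_generator_radial (hL : LossRegular L ML CL Mg Cg)
    {h h' h'' : ℝ → ℝ} (hh : ∀ u, HasDerivAt h (h' u) u) (hh' : ∀ u, HasDerivAt h' (h'' u) u)
    (hc : Continuous h'') (lam₁ lam₂ σ₁ σ₂ : ℝ) (m c : E d) :
    Continuous (generator L lam₁ lam₂ σ₁ σ₂ m (fun y => h (‖y - c‖ ^ 2))) := by
  have h1 := hL.continuous_gradient
  have h2 : Continuous h' := continuous_iff_continuousAt.2 fun u => (hh' u).continuousAt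
  rw [funext fun x => generator_radial hh hh' L lam₁ lam₂ σ₁ σ₂ m c x]
  fun_prop

end Loss

/-- Grönwall's inequality for a differential inequality on an open interval. -/
theorem le_exp_of_deriv_le {f f' : ℝ → ℝ} {t κ e : ℝ} (ht : 0 ≤ t) (hκ : 0 < κ) (he : 0 ≤ e)
    (hc : ContinuousOn f (Icc 0 t)) (hd : ∀ s ∈ Ioo 0 t, HasDerivAt f (f' s) s)
    (hle : ∀ s ∈ Ioo 0 t, f' s ≤ -κ * f s + e) :
    f t ≤ f 0 * Real.exp (-(κ * t)) + e / κ := by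
  -- Subtracting the equilibrium `e / κ` makes the inequality homogeneous, so the integrating factor
  -- yields a nonincreasing function.
  have hd' : ∀ s ∈ Ioo 0 t, HasDerivAt (fun s => (f s - e / κ) * Real.exp (κ * s))
      (f' s * Real.exp (κ * s) + (f s - e / κ) * (Real.exp (κ * s) * κ)) s := fun s hs =>
    ((hd s hs).sub_const _).mul (by simpa using ((hasDerivAt_id s).const_mul κ).exp)
  have hanti : AntitoneOn (fun s => (f s - e / κ) * Real.exp (κ * s)) (Icc 0 t) := by
    refine antitoneOn_of_deriv_nonpos (convex_Icc 0 t) (by fun_prop) ?_ ?_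
    · rw [interior_Icc]
      exact fun s hs => (hd' s hs).differentiableAt.differentiableWithinAt
    · rw [interior_Icc]
      intro s hs
      rw [(hd' s hs).deriv]
      have h1 : f' s + (f s - e / κ) * κ ≤ 0 := by
        have := hle s hs
        rw [sub_mul, div_mul_cancel₀ _ hκ.ne']
        linarith
      have h2 := mul_nonpos_of_nonpos_of_nonneg h1 (Real.exp_pos (κ * s)).le
      linarith
  have h1 := hanti ⟨le_rfl, ht⟩ ⟨ht, le_rfl⟩ ht
  simp only [mul_zero, Real.exp_zero, mul_one] at h1
  have h2 : f t - e / κ ≤ (f 0 - e / κ) * Real.exp (-(κ * t)) := by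
    rw [Real.exp_neg, ← div_eq_mul_inv, le_div_iff₀ (Real.exp_pos _)]
    exact h1
  have h3 : 0 ≤ e / κ * Real.exp (-(κ * t)) := by positivity
  linarith

/-- The generator is local. With continuity this makes it integrable against any probability
measure. -/
theorem hasCompactSupport_generator {φ : E d → ℝ} (hφ : HasCompactSupport φ) (L : E d → ℝ)
    (lam₁ lam₂ σ₁ σ₂ : ℝ) (m : E d) :
    HasCompactSupport (generator L lam₁ lam₂ σ₁ σ₂ m φ) := by
  refine HasCompactSupport.intro hφ fun x hx => ?_
  have h0 : φ =ᶠ[𝓝 x] fun _ => 0 := notMem_tsupport_iff_eventuallyEq.1 hx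
  have h1 : gradient φ x = 0 := by rw [h0.gradient_eq, gradient_fun_const]
  have h2 : Laplacian.laplacian φ x = 0 := by
    rw [(InnerProductSpace.laplacian_congr_nhds h0).eq_of_nhds]
    simp
  simp [generator, h1, h2]

section Dissipation

variable {L : E d → ℝ} {ML CL Mg Cg : ℝ}

/-! ### Lower bound for the generator on a bump supported in a ball -/

section Ball

/-- The smooth bump `exp(-1/(1 - |x-c|²/r²))` supported in the ball `B_r(c)`. -/
noncomputable def ballBump (c : E d) (r : ℝ) (x : E d) : ℝ :=
  expNegInvGlue (1 - ‖x - c‖ ^ 2 / r ^ 2)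

/-- The formula also covers `s ≤ 0`, where both sides vanish, so no case distinction at the edge of
the ball is needed. -/
theorem hasDerivAt_expNegInvGlue (s : ℝ) :
    HasDerivAt expNegInvGlue (s⁻¹ ^ 2 * expNegInvGlue s) s := by
  simpa using expNegInvGlue.hasDerivAt_polynomial_eval_inv_mul 1 s

theorem hasDerivAt_inv_sq_mul_expNegInvGlue (s : ℝ) :
    HasDerivAt (fun s => s⁻¹ ^ 2 * expNegInvGlue s)
      ((s⁻¹ ^ 4 - 2 * s⁻¹ ^ 3) * expNegInvGlue s) s := by
  have := expNegInvGlue.hasDerivAt_polynomial_eval_inv_mul (Polynomial.X ^ 2) s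
  simp only [Polynomial.eval_pow, Polynomial.eval_X, Polynomial.eval_mul, Polynomial.eval_sub,
    Polynomial.derivative_X_pow, Polynomial.eval_natCast, map_natCast] at this
  convert this using 1
  norm_num
  left
  ring

theorem continuous_expNegInvGlue_second :
    Continuous fun s : ℝ => (s⁻¹ ^ 4 - 2 * s⁻¹ ^ 3) * expNegInvGlue s := by
  have := expNegInvGlue.continuous_polynomial_eval_inv_mul
    (Polynomial.X ^ 4 - 2 * Polynomial.X ^ 3)
  simpa using this

theorem hasDerivAt_one_sub_div (r u : ℝ) :
    HasDerivAt (fun u : ℝ => 1 - u / r ^ 2) (-(1 / r ^ 2)) u := by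
  simpa using ((hasDerivAt_id u).div_const (r ^ 2)).const_sub 1

theorem hasDerivAt_bumpProfile (r u : ℝ) :
    HasDerivAt (fun u => expNegInvGlue (1 - u / r ^ 2))
      (-(1 / r ^ 2) * ((1 - u / r ^ 2)⁻¹ ^ 2 * expNegInvGlue (1 - u / r ^ 2))) u := by
  have := (hasDerivAt_expNegInvGlue (1 - u / r ^ 2)).comp u (hasDerivAt_one_sub_div r u)
  rw [mul_comm]
  exact this

theorem hasDerivAt_bumpProfile_deriv (r u : ℝ) :
    HasDerivAt (fun u =>
        -(1 / r ^ 2) * ((1 - u / r ^ 2)⁻¹ ^ 2 * expNegInvGlue (1 - u / r ^ 2)))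
      ((1 / r ^ 2) ^ 2 * (((1 - u / r ^ 2)⁻¹ ^ 4 - 2 * (1 - u / r ^ 2)⁻¹ ^ 3) *
        expNegInvGlue (1 - u / r ^ 2))) u := by
  have := ((hasDerivAt_inv_sq_mul_expNegInvGlue (1 - u / r ^ 2)).comp u
    (hasDerivAt_one_sub_div r u)).const_mul (-(1 / r ^ 2))
  refine this.congr_deriv ?_
  ring

theorem contDiff_ballBump (c : E d) (r : ℝ) : ContDiff ℝ ∞ (ballBump c r) :=
  contDiff_radial (h := fun u => expNegInvGlue (1 - u / r ^ 2))
    (expNegInvGlue.contDiff.comp (contDiff_const.sub (contDiff_id.div_const _))) c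

theorem hasCompactSupport_ballBump (c : E d) {r : ℝ} (hr : 0 < r) :
    HasCompactSupport (ballBump c r) := by
  refine hasCompactSupport_radial (h := fun u => expNegInvGlue (1 - u / r ^ 2)) (R := r)
    (fun u hu => expNegInvGlue.zero_of_nonpos ?_) hr.le c
  rw [sub_nonpos, le_div_iff₀ (by positivity)]
  linarith

theorem ballBump_nonneg (c : E d) (r : ℝ) (x : E d) : 0 ≤ ballBump c r x :=
  expNegInvGlue.nonneg _

theorem ballBump_le_one (c : E d) (r : ℝ) (x : E d) : ballBump c r x ≤ 1 := by
  rw [ballBump, expNegInvGlue]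
  split_ifs with h
  · exact zero_le_one
  · exact Real.exp_le_one_iff.2 (neg_nonpos.2 (inv_nonneg.2 (not_le.1 h).le))

theorem ballBump_pos_iff {c : E d} {r : ℝ} (hr : 0 < r) {x : E d} :
    0 < ballBump c r x ↔ x ∈ Metric.ball c r := by
  rw [Metric.mem_ball, dist_eq_norm, (ballBump_nonneg c r x).lt_iff_ne', ballBump, Ne,
    expNegInvGlue.zero_iff_nonpos, not_le, sub_pos, div_lt_one (by positivity),
    sq_lt_sq₀ (norm_nonneg _) hr.le]

theorem integrable_ballBump (c : E d) {r : ℝ} (hr : 0 < r) (μ : Measure (E d))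
    [IsFiniteMeasure μ] : Integrable (ballBump c r) μ :=
  (contDiff_ballBump c r).continuous.integrable_of_hasCompactSupport
    (hasCompactSupport_ballBump c hr)

theorem integral_ballBump_le (c : E d) {r : ℝ} (hr : 0 < r) (μ : Measure (E d))
    [IsFiniteMeasure μ] : ∫ x, ballBump c r x ∂μ ≤ μ.real (Metric.ball c r) := by
  rw [← integral_indicator_one Metric.isOpen_ball.measurableSet]
  refine integral_mono (integrable_ballBump c hr μ)
    ((integrable_const (1 : ℝ)).indicator Metric.isOpen_ball.measurableSet) fun x => ?_
  by_cases hx : x ∈ Metric.ball c r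
  · simpa [hx] using ballBump_le_one c r x
  · rw [← ballBump_pos_iff hr, not_lt] at hx
    exact hx.trans (indicator_nonneg (fun _ _ => zero_le_one) _)

theorem integral_ballBump_pos (c : E d) {r : ℝ} (hr : 0 < r) (μ : Measure (E d))
    [IsFiniteMeasure μ] (hμ : 0 < μ (Metric.ball c r)) : 0 < ∫ x, ballBump c r x ∂μ := by
  rw [integral_pos_iff_support_of_nonneg (ballBump_nonneg c r) (integrable_ballBump c hr μ)]
  convert hμ using 2
  ext x
  rw [← ballBump_pos_iff hr, Function.mem_support, (ballBump_nonneg c r x).lt_iff_ne']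

/-- With `a` the dimension, the right side is the bracket multiplying the diffusion coefficient,
cleared of powers of `s⁻¹`. It tends to `4` as `s → 0`, the edge of the ball, hence exceeds `1`
there; for larger `s` it is bounded below and `K s⁴` makes up the difference. -/
theorem exists_bump_polynomial_bound (a : ℝ) (ha : 0 ≤ a) :
    ∃ K : ℝ, 0 ≤ K ∧ ∀ s, 0 < s → s ≤ 1 →
      1 - K * s ^ 4 ≤ 4 * (1 - s) * (1 - 2 * s) - 2 * a * s ^ 2 := by
  set s₀ : ℝ := 1 / (2 * (a + 12)) with hs₀
  have hs₀pos : 0 < s₀ := by positivity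
  have h12 : (a + 12) * s₀ = 1 / 2 := by rw [hs₀]; field_simp
  refine ⟨(9 + 2 * a) / s₀ ^ 4, by positivity, fun s hs hs1 => ?_⟩
  have hs2 : s ^ 2 ≤ s := by nlinarith
  rcases le_or_gt s s₀ with h | h
  · have h0 : 0 ≤ (9 + 2 * a) / s₀ ^ 4 * s ^ 4 := by positivity
    have h1 : (a + 12) * s ≤ 1 / 2 := by rw [← h12]; gcongr
    nlinarith [mul_le_mul_of_nonneg_left hs2 ha]
  · have h0 : 9 + 2 * a ≤ (9 + 2 * a) / s₀ ^ 4 * s ^ 4 := by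
      rw [div_mul_eq_mul_div, le_div_iff₀ (by positivity)]
      gcongr
    nlinarith [mul_le_mul_of_nonneg_left hs2 ha, mul_le_mul_of_nonneg_left hs1 ha]

/-- The squared drift is controlled by the diffusion coefficient. -/
theorem norm_drift_sq_le {lam₁ lam₂ σ₁ σ₂ : ℝ} (hσ₁ : 0 < σ₁) (hσ₂ : 0 < σ₂) (u v : E d) :
    ‖-(lam₁ • u) - lam₂ • v‖ ^ 2 ≤ 4 * (lam₁ ^ 2 / σ₁ ^ 2 + lam₂ ^ 2 / σ₂ ^ 2) *
      (σ₁ ^ 2 / 2 * ‖u‖ ^ 2 + σ₂ ^ 2 / 2 * ‖v‖ ^ 2) := by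
  have h1 : ‖-(lam₁ • u) - lam₂ • v‖ ≤ |lam₁| * ‖u‖ + |lam₂| * ‖v‖ := by
    refine (norm_sub_le _ _).trans ?_
    rw [norm_neg, norm_smul, norm_smul, Real.norm_eq_abs, Real.norm_eq_abs]
  have h2 : (|lam₁| * ‖u‖ + |lam₂| * ‖v‖) ^ 2 ≤ 2 * lam₁ ^ 2 * ‖u‖ ^ 2 + 2 * lam₂ ^ 2 * ‖v‖ ^ 2 := by
    have := sq_nonneg (|lam₁| * ‖u‖ - |lam₂| * ‖v‖)
    rw [← sq_abs lam₁, ← sq_abs lam₂]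
    nlinarith
  refine (pow_le_pow_left₀ (norm_nonneg _) h1 2).trans (h2.trans ?_)
  have e : 4 * (lam₁ ^ 2 / σ₁ ^ 2 + lam₂ ^ 2 / σ₂ ^ 2) *
      (σ₁ ^ 2 / 2 * ‖u‖ ^ 2 + σ₂ ^ 2 / 2 * ‖v‖ ^ 2) =
      2 * lam₁ ^ 2 * ‖u‖ ^ 2 + 2 * lam₂ ^ 2 * ‖v‖ ^ 2 +
      (2 * (lam₁ ^ 2 / σ₁ ^ 2) * σ₂ ^ 2 * ‖v‖ ^ 2 +
        2 * (lam₂ ^ 2 / σ₂ ^ 2) * σ₁ ^ 2 * ‖u‖ ^ 2) := by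
    field_simp
    ring
  rw [e]
  have : 0 ≤ 2 * (lam₁ ^ 2 / σ₁ ^ 2) * σ₂ ^ 2 * ‖v‖ ^ 2 +
        2 * (lam₂ ^ 2 / σ₂ ^ 2) * σ₁ ^ 2 * ‖u‖ ^ 2 := by positivity
  linarith

/-- Young's inequality without division by `D`: the diffusion coefficient may vanish, but then so
does the drift `b`. -/
theorem two_mul_mul_le_of_sq_le {C D z b : ℝ} (hC : 0 < C) (hb : b ^ 2 ≤ C * D) :
    2 * z * b ≤ D * z ^ 2 + C := by
  have h1 : 0 ≤ (C - z * b) ^ 2 := sq_nonneg _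
  have h2 : z ^ 2 * b ^ 2 ≤ z ^ 2 * (C * D) := by gcongr
  have h3 : C * (2 * z * b) ≤ C * (D * z ^ 2 + C) := by nlinarith
  exact le_of_mul_le_mul_left h3 hC

/-- The bump is almost a subsolution: its mass decays at most exponentially. -/
theorem LossRegular.exists_generator_ballBump_ge (hL : LossRegular L ML CL Mg Cg)
    {lam₁ lam₂ σ₁ σ₂ : ℝ} (hlam₁ : 0 < lam₁) (hσ₁ : 0 < σ₁) (hσ₂ : 0 < σ₂) (c : E d) (B : ℝ)
    {r : ℝ} (hr : 0 < r) :
    ∃ p : ℝ, 0 < p ∧ ∀ m : E d, ‖m - c‖ ≤ B → ∀ x,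
      -p * ballBump c r x ≤ generator L lam₁ lam₂ σ₁ σ₂ m (ballBump c r) x := by
  obtain ⟨K, hK0, hK⟩ := exists_bump_polynomial_bound d (Nat.cast_nonneg d)
  set C : ℝ := 4 * (lam₁ ^ 2 / σ₁ ^ 2 + lam₂ ^ 2 / σ₂ ^ 2) with hC
  have hCpos : 0 < C := by positivity
  set Dm : ℝ := σ₁ ^ 2 / 2 * (r + |B|) ^ 2 + σ₂ ^ 2 / 2 * Cg ^ 2 with hDm
  have hDm0 : 0 ≤ Dm := by positivity
  -- `C` is left over when the diffusion absorbs the drift; `K * Dm / r ^ 2` is the loss in the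
  -- polynomial bound, with `Dm` the largest diffusion coefficient on the ball.
  refine ⟨C + K * Dm / r ^ 2, by positivity, fun m hm x => ?_⟩
  have hgen := generator_radial (hasDerivAt_bumpProfile r) (hasDerivAt_bumpProfile_deriv r) L
    lam₁ lam₂ σ₁ σ₂ m c x
  change generator L lam₁ lam₂ σ₁ σ₂ m (ballBump c r) x = _ at hgen
  rw [hgen, ballBump]
  set s : ℝ := 1 - ‖x - c‖ ^ 2 / r ^ 2 with hs
  rcases le_or_gt s 0 with hs0 | hs0
  · simp [expNegInvGlue.zero_of_nonpos hs0]
  have hψ : 0 < expNegInvGlue s := expNegInvGlue.pos_of_pos hs0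
  set ψ := expNegInvGlue s
  set b : E d := -(lam₁ • (x - m)) - lam₂ • gradient L x with hb
  set D : ℝ := σ₁ ^ 2 / 2 * ‖x - m‖ ^ 2 + σ₂ ^ 2 / 2 * ‖gradient L x‖ ^ 2 with hD
  have hD0 : 0 ≤ D := by positivity
  have hu : ‖x - c‖ ^ 2 = r ^ 2 * (1 - s) := by rw [hs]; field_simp; ring
  have hs1 : s ≤ 1 := by
    rw [hs]; have : 0 ≤ ‖x - c‖ ^ 2 / r ^ 2 := by positivity
    linarith
  have hxr : ‖x - c‖ ≤ r := by
    refine le_of_sq_le_sq ?_ hr.le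
    rw [hu]; nlinarith [sq_nonneg r]
  have hxm : ‖x - m‖ ≤ r + |B| := by
    have h1 : ‖x - m‖ ≤ ‖x - c‖ + ‖m - c‖ := by
      simpa [dist_eq_norm] using dist_triangle_right x m c
    linarith [le_abs_self B]
  have hDle : D ≤ Dm := by
    rw [hD, hDm]
    gcongr
    exact hL.bdd_grad x
  have hbD : ‖b‖ ^ 2 ≤ C * D := norm_drift_sq_le hσ₁ hσ₂ _ _
  have hβ : inner ℝ b (x - c) ≤ ‖b‖ * r :=
    (real_inner_le_norm _ _).trans (by gcongr)
  set β : ℝ := inner ℝ b (x - c)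
  rw [hu]
  set i : ℝ := s⁻¹ with hi
  have his : i * s = 1 := inv_mul_cancel₀ hs0.ne'
  have hi0 : 0 < i := inv_pos.2 hs0
  have e : 2 * (-(1 / r ^ 2) * (i ^ 2 * ψ)) * β +
      D * (4 * ((1 / r ^ 2) ^ 2 * ((i ^ 4 - 2 * i ^ 3) * ψ)) * (r ^ 2 * (1 - s)) +
        2 * d * (-(1 / r ^ 2) * (i ^ 2 * ψ))) =
      (-(2 * (i ^ 2 / r ^ 2) * β) +
        D / r ^ 2 * (4 * (1 - s) * (i ^ 4 - 2 * i ^ 3) - 2 * d * i ^ 2)) * ψ := by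
    field_simp
    ring
  rw [e]
  refine mul_le_mul_of_nonneg_right ?_ hψ.le
  have k1 : i ^ 4 - K ≤ 4 * (1 - s) * (i ^ 4 - 2 * i ^ 3) - 2 * d * i ^ 2 := by
    have := mul_le_mul_of_nonneg_left (hK s hs0 hs1) (by positivity : 0 ≤ i ^ 4)
    have e1 : i ^ 4 * (1 - K * s ^ 4) = i ^ 4 - K := by
      have : i ^ 4 * s ^ 4 = 1 := by rw [← mul_pow, his, one_pow]
      linear_combination (-K) * this
    have e2 : i ^ 4 * (4 * (1 - s) * (1 - 2 * s) - 2 * d * s ^ 2) =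
        4 * (1 - s) * (i ^ 4 - 2 * i ^ 3) - 2 * d * i ^ 2 := by
      have h1 : i ^ 4 * s = i ^ 3 := by linear_combination i ^ 3 * his
      have h2 : i ^ 4 * s ^ 2 = i ^ 2 := by
        linear_combination i ^ 2 * (i * s + 1) * his
      linear_combination (-(8 : ℝ) * (1 - s)) * h1 - 2 * d * h2
    rwa [e1, e2] at this
  -- The singular drift term is paid for by exactly the `D i⁴ / r²` that the second derivative of
  -- the bump supplies.
  have k2 : 2 * (i ^ 2 / r ^ 2) * β ≤ D * (i ^ 2 / r) ^ 2 + C := by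
    calc 2 * (i ^ 2 / r ^ 2) * β ≤ 2 * (i ^ 2 / r ^ 2) * (‖b‖ * r) := by gcongr
      _ = 2 * (i ^ 2 / r) * ‖b‖ := by field_simp
      _ ≤ _ := two_mul_mul_le_of_sq_le hCpos hbD
  have k3 : D / r ^ 2 * (i ^ 4 - K) ≤
      D / r ^ 2 * (4 * (1 - s) * (i ^ 4 - 2 * i ^ 3) - 2 * d * i ^ 2) := by gcongr
  have k4 : D / r ^ 2 * (i ^ 4 - K) = D * (i ^ 2 / r) ^ 2 - K * D / r ^ 2 := by
    field_simp
  have k5 : K * D / r ^ 2 ≤ K * Dm / r ^ 2 := by gcongr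
  linarith

end Ball

/-! ### Dissipation of the truncated square -/

section Variance

/-- A smooth compactly supported function on `[0,∞)` equal to `v/2` for `v ≤ 1`. -/
noncomputable def cutoff (v : ℝ) : ℝ := v / 2 * Real.smoothTransition (2 - v)

theorem contDiff_cutoff : ContDiff ℝ ∞ cutoff :=
  (contDiff_id.div_const 2).mul
    (Real.smoothTransition.contDiff.comp (contDiff_const.sub contDiff_id))

theorem contDiff_deriv_cutoff : ContDiff ℝ ∞ (deriv cutoff) := by
  have := contDiff_cutoff
  rw [contDiff_infty_iff_deriv] at this
  exact this.2

theorem hasDerivAt_cutoff (v : ℝ) : HasDerivAt cutoff (deriv cutoff v) v :=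
  (contDiff_cutoff.differentiable (by simp) v).hasDerivAt

theorem hasDerivAt_deriv_cutoff (v : ℝ) :
    HasDerivAt (deriv cutoff) (deriv (deriv cutoff) v) v :=
  (contDiff_deriv_cutoff.differentiable (by simp) v).hasDerivAt

theorem continuous_deriv_deriv_cutoff : Continuous (deriv (deriv cutoff)) :=
  contDiff_deriv_cutoff.continuous_deriv (by simp)

theorem cutoff_of_two_le {v : ℝ} (hv : 2 ≤ v) : cutoff v = 0 := by
  rw [cutoff, Real.smoothTransition.zero_of_nonpos (by linarith), mul_zero]

theorem cutoff_of_le_one {v : ℝ} (hv : v ≤ 1) : cutoff v = v / 2 := by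
  rw [cutoff, Real.smoothTransition.one_of_one_le (by linarith), mul_one]

theorem cutoff_nonneg {v : ℝ} (hv : 0 ≤ v) : 0 ≤ cutoff v :=
  mul_nonneg (by linarith) (Real.smoothTransition.nonneg _)

theorem cutoff_le {v : ℝ} (hv : 0 ≤ v) : cutoff v ≤ v / 2 :=
  mul_le_of_le_one_right (by linarith) (Real.smoothTransition.le_one _)

theorem deriv_cutoff_of_lt_one {v : ℝ} (hv : v < 1) : deriv cutoff v = 1 / 2 := by
  have : cutoff =ᶠ[𝓝 v] fun v => v / 2 := by
    filter_upwards [Iio_mem_nhds hv] with u hu using cutoff_of_le_one (le_of_lt hu)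
  rw [this.deriv_eq]
  simp

theorem deriv_deriv_cutoff_of_lt_one {v : ℝ} (hv : v < 1) : deriv (deriv cutoff) v = 0 := by
  have : deriv cutoff =ᶠ[𝓝 v] fun _ => 1 / 2 := by
    filter_upwards [Iio_mem_nhds hv] with u hu using deriv_cutoff_of_lt_one hu
  rw [this.deriv_eq]
  simp

theorem deriv_cutoff_of_two_lt {v : ℝ} (hv : 2 < v) : deriv cutoff v = 0 := by
  have : cutoff =ᶠ[𝓝 v] fun _ => 0 := by
    filter_upwards [Ioi_mem_nhds hv] with u hu using cutoff_of_two_le (le_of_lt hu)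
  rw [this.deriv_eq]
  simp

theorem deriv_deriv_cutoff_of_two_lt {v : ℝ} (hv : 2 < v) : deriv (deriv cutoff) v = 0 := by
  have : deriv cutoff =ᶠ[𝓝 v] fun _ => 0 := by
    filter_upwards [Ioi_mem_nhds hv] with u hu using deriv_cutoff_of_two_lt hu
  rw [this.deriv_eq]
  simp

/-- These two quantities are invariant under the rescaling in `truncSq`, so one `G` serves for every
`N`. -/
theorem exists_cutoff_bound : ∃ G : ℝ, 0 ≤ G ∧ ∀ v, 0 ≤ v →
    |deriv cutoff v| ≤ G ∧ |v * deriv (deriv cutoff) v| ≤ G := by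
  obtain ⟨G₁, h₁⟩ := (isCompact_Icc (a := (0 : ℝ)) (b := 2)).exists_bound_of_continuousOn
    contDiff_deriv_cutoff.continuous.continuousOn
  obtain ⟨G₂, h₂⟩ := (isCompact_Icc (a := (0 : ℝ)) (b := 2)).exists_bound_of_continuousOn
    (continuous_id.mul continuous_deriv_deriv_cutoff).continuousOn
  have h0 : 0 ≤ G₁ := (norm_nonneg _).trans (h₁ 0 ⟨le_rfl, zero_le_two⟩)
  refine ⟨max G₁ G₂, h0.trans (le_max_left _ _), fun v hv => ?_⟩
  rcases le_or_gt v 2 with h | h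
  · exact ⟨(h₁ v ⟨hv, h⟩).trans (le_max_left _ _), (h₂ v ⟨hv, h⟩).trans (le_max_right _ _)⟩
  · simp [deriv_cutoff_of_two_lt h, deriv_deriv_cutoff_of_two_lt h, h0]

/-- The truncation `N · cutoff(|x - c|² / N)` of `|x - c|² / 2`. -/
noncomputable def truncSq (c : E d) (N : ℝ) (x : E d) : ℝ := N * cutoff (‖x - c‖ ^ 2 / N)

theorem hasDerivAt_truncProfile {N : ℝ} (hN : 0 < N) (u : ℝ) :
    HasDerivAt (fun u => N * cutoff (u / N)) (deriv cutoff (u / N)) u := by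
  have := ((hasDerivAt_cutoff (u / N)).comp u ((hasDerivAt_id u).div_const N)).const_mul N
  refine this.congr_deriv ?_
  field_simp

theorem hasDerivAt_truncProfile_deriv (N : ℝ) (u : ℝ) :
    HasDerivAt (fun u => deriv cutoff (u / N)) (deriv (deriv cutoff) (u / N) * (1 / N)) u := by
  have h1 : HasDerivAt (fun u : ℝ => u / N) (1 / N) u := (hasDerivAt_id' u).div_const N
  exact (hasDerivAt_deriv_cutoff (u / N)).comp u h1

theorem contDiff_truncSq (c : E d) (N : ℝ) : ContDiff ℝ ∞ (truncSq c N) :=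
  contDiff_radial (h := fun u => N * cutoff (u / N))
    (contDiff_const.mul (contDiff_cutoff.comp (contDiff_id.div_const _))) c

theorem hasCompactSupport_truncSq (c : E d) {N : ℝ} (hN : 0 < N) :
    HasCompactSupport (truncSq c N) := by
  refine hasCompactSupport_radial (h := fun u => N * cutoff (u / N)) (R := √(2 * N))
    (fun u hu => ?_) (Real.sqrt_nonneg _) c
  rw [Real.sq_sqrt (by positivity)] at hu
  rw [cutoff_of_two_le (by rwa [le_div_iff₀ hN]), mul_zero]

theorem truncSq_le (c : E d) {N : ℝ} (hN : 0 < N) (x : E d) :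
    truncSq c N x ≤ ‖x - c‖ ^ 2 / 2 := by
  have := mul_le_mul_of_nonneg_left (cutoff_le (v := ‖x - c‖ ^ 2 / N) (by positivity)) hN.le
  refine this.trans_eq ?_
  field_simp

/-- The truncation changes nothing where `|x - c|² ≤ N`; elsewhere a factor `|x - c|² / N ≥ 1` is
free. -/
theorem le_truncSq_add (c : E d) {N : ℝ} (hN : 0 < N) (x : E d) :
    ‖x - c‖ ^ 2 / 2 ≤ truncSq c N x + ‖x - c‖ ^ 4 / N := by
  rcases le_or_gt (‖x - c‖ ^ 2 / N) 1 with h | h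
  · rw [truncSq, cutoff_of_le_one h]
    have : 0 ≤ ‖x - c‖ ^ 4 / N := by positivity
    have e : N * (‖x - c‖ ^ 2 / N / 2) = ‖x - c‖ ^ 2 / 2 := by field_simp
    linarith
  · have h0 : 0 ≤ truncSq c N x := mul_nonneg hN.le (cutoff_nonneg (by positivity))
    have h1 : ‖x - c‖ ^ 2 * 1 ≤ ‖x - c‖ ^ 2 * (‖x - c‖ ^ 2 / N) := by gcongr
    have e : ‖x - c‖ ^ 2 * (‖x - c‖ ^ 2 / N) = ‖x - c‖ ^ 4 / N := by ring
    nlinarith [sq_nonneg ‖x - c‖]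

/-- The generator applied to the truncated square is dissipative up to a small error. -/
theorem LossRegular.exists_generator_truncSq_le (hL : LossRegular L ML CL Mg Cg)
    {lam₁ lam₂ σ₁ σ₂ M δ τ B : ℝ} (hlam₁ : 0 < lam₁) (hlam₂ : 0 < lam₂) {θ : E d}
    (hθ : L θ = ⨅ z, L z) (hM : Mg ≤ M) (hδ : δ = rate d lam₁ lam₂ σ₁ σ₂ M) (hδ0 : 0 < δ)
    (hτ : τ ∈ Ioo (0 : ℝ) 1) (hB : 0 ≤ B) :
    ∃ C : ℝ, 0 ≤ C ∧ ∀ N : ℝ, 0 < N → ∀ m : E d, ‖m - θ‖ ≤ B → ∀ x,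
      generator L lam₁ lam₂ σ₁ σ₂ m (truncSq θ N) x ≤
        -((1 - τ / 2) * δ) * (‖x - θ‖ ^ 2 / 2) +
          ((lam₁ + d * σ₁ ^ 2) ^ 2 / (τ * δ) + d * σ₁ ^ 2 / 2) * B ^ 2 +
          C / N * (1 + ‖x - θ‖ ^ 4) := by
  obtain ⟨G, hG0, hG⟩ := exists_cutoff_bound
  have hM0 : 0 < M := hL.Mg_pos.trans_le hM
  obtain ⟨hτ0, hτ1⟩ := hτ
  set A₁ : ℝ := lam₁ * (1 + B) + lam₂ * M with hA₁
  set A₂ : ℝ := σ₁ ^ 2 * (1 + B ^ 2) + σ₂ ^ 2 / 2 * M ^ 2 with hA₂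
  -- The first two terms bound the generator in the far region; the summand `δ` compensates the
  -- negative dissipation term on the right, which the cut-off function no longer provides there.
  set A : ℝ := 2 * G * A₁ + A₂ * (4 * G + 2 * d * G) + δ with hA
  have hA₁0 : 0 ≤ A₁ := by positivity
  have hA₂0 : 0 ≤ A₂ := by positivity
  have hA0 : 0 ≤ A := by positivity
  refine ⟨2 * A, by positivity, fun N hN m hm x => ?_⟩
  have hgen := generator_radial (hasDerivAt_truncProfile hN) (hasDerivAt_truncProfile_deriv N) L
    lam₁ lam₂ σ₁ σ₂ m θ x
  change generator L lam₁ lam₂ σ₁ σ₂ m (truncSq θ N) x = _ at hgen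
  rw [hgen]
  set n : ℝ := ‖x - θ‖ with hn
  have hn0 : 0 ≤ n := norm_nonneg _
  set g := gradient L x
  have hg : ‖g‖ ≤ M * n := (hL.norm_gradient_le hθ x).trans (by gcongr)
  have hxm : ‖x - m‖ ≤ n + B := by
    have h1 : ‖x - m‖ ≤ ‖x - θ‖ + ‖m - θ‖ := by
      simpa [dist_eq_norm] using dist_triangle_right x m θ
    linarith
  set D : ℝ := σ₁ ^ 2 / 2 * ‖x - m‖ ^ 2 + σ₂ ^ 2 / 2 * ‖g‖ ^ 2 with hD
  have hD0 : 0 ≤ D := by positivity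
  have hDle : D ≤ σ₁ ^ 2 / 2 * (n + B) ^ 2 + σ₂ ^ 2 / 2 * (M * n) ^ 2 := by
    rw [hD]; gcongr
  set β : ℝ := inner ℝ (-(lam₁ • (x - m)) - lam₂ • g) (x - θ) with hβ
  have hβe : β = -lam₁ * n ^ 2 + lam₁ * inner ℝ (m - θ) (x - θ) - lam₂ * inner ℝ g (x - θ) := by
    have e : x - m = (x - θ) - (m - θ) := by abel
    rw [hβ, e, inner_sub_left, inner_neg_left, inner_smul_left, inner_smul_left, inner_sub_left,
      real_inner_self_eq_norm_sq]
    simp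
    ring
  have h1 : |inner ℝ (m - θ) (x - θ)| ≤ B * n :=
    (abs_real_inner_le_norm _ _).trans (by gcongr)
  have h2 : |inner ℝ g (x - θ)| ≤ M * n * n :=
    (abs_real_inner_le_norm _ _).trans (by gcongr)
  rw [abs_le] at h1 h2
  have hβle : β ≤ -lam₁ * n ^ 2 + lam₁ * (B * n) + lam₂ * (M * n * n) := by
    rw [hβe]
    linarith [mul_le_mul_of_nonneg_left h1.2 hlam₁.le, mul_le_mul_of_nonneg_left h2.1 hlam₂.le]
  have hβge : -(lam₁ * n ^ 2 + lam₁ * (B * n) + lam₂ * (M * n * n)) ≤ β := by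
    rw [hβe]
    linarith [mul_le_mul_of_nonneg_left h1.1 hlam₁.le, mul_le_mul_of_nonneg_left h2.2 hlam₂.le]
  set K : ℝ := (lam₁ + d * σ₁ ^ 2) ^ 2 / (τ * δ) + d * σ₁ ^ 2 / 2 with hK
  have hK0 : 0 ≤ K := by positivity
  have herr : 0 ≤ 2 * A / N * (1 + n ^ 4) := by positivity
  rcases lt_or_ge (n ^ 2 / N) 1 with hv | hv
  · rw [deriv_cutoff_of_lt_one hv, deriv_deriv_cutoff_of_lt_one hv]
    have hdD := mul_le_mul_of_nonneg_left hDle (Nat.cast_nonneg d : (0 : ℝ) ≤ d)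
    -- The weights spend exactly the fraction `τ / 2` of the dissipation `δ n² / 2`.
    have hyoung : (lam₁ + d * σ₁ ^ 2) * B * n ≤
        τ * δ / 4 * n ^ 2 + (lam₁ + d * σ₁ ^ 2) ^ 2 / (τ * δ) * B ^ 2 := by
      have hs : 0 ≤ (τ * δ / 2 * n - (lam₁ + d * σ₁ ^ 2) * B) ^ 2 / (τ * δ) := by positivity
      have e : (τ * δ / 2 * n - (lam₁ + d * σ₁ ^ 2) * B) ^ 2 / (τ * δ) =
          τ * δ / 4 * n ^ 2 + (lam₁ + d * σ₁ ^ 2) ^ 2 / (τ * δ) * B ^ 2 -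
            (lam₁ + d * σ₁ ^ 2) * B * n := by
        field_simp
        ring
      linarith
    have hmain : β + d * D ≤ -((1 - τ / 2) * δ) * (n ^ 2 / 2) + K * B ^ 2 := by
      have e : -lam₁ * n ^ 2 + lam₁ * (B * n) + lam₂ * (M * n * n) +
          d * (σ₁ ^ 2 / 2 * (n + B) ^ 2 + σ₂ ^ 2 / 2 * (M * n) ^ 2) =
          -δ * (n ^ 2 / 2) + (lam₁ + d * σ₁ ^ 2) * B * n + d * σ₁ ^ 2 / 2 * B ^ 2 := by
        rw [hδ, rate]; ring
      have e2 : K * B ^ 2 = (lam₁ + d * σ₁ ^ 2) ^ 2 / (τ * δ) * B ^ 2 +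
          d * σ₁ ^ 2 / 2 * B ^ 2 := by rw [hK]; ring
      rw [e2]
      linarith
    linarith
  · obtain ⟨hG1, hG2⟩ := hG (n ^ 2 / N) (by positivity)
    set c₁ := deriv cutoff (n ^ 2 / N)
    set c₂ := deriv (deriv cutoff) (n ^ 2 / N)
    have hn1 : n ≤ 1 + n ^ 2 := by linarith [two_mul_le_add_sq n 1, sq_nonneg n]
    have hβabs : |β| ≤ A₁ * (1 + n ^ 2) := by
      have : lam₁ * n ^ 2 + lam₁ * (B * n) + lam₂ * (M * n * n) ≤ A₁ * (1 + n ^ 2) := by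
        have p1 := mul_le_mul_of_nonneg_left hn1 (by positivity : 0 ≤ lam₁ * B)
        have p2 : 0 ≤ lam₂ * M := by positivity
        have p3 : 0 ≤ lam₁ := hlam₁.le
        calc _ ≤ lam₁ * n ^ 2 + lam₁ * B * (1 + n ^ 2) + lam₂ * M * n ^ 2 := by linarith
          _ ≤ lam₁ * n ^ 2 + lam₁ * B * (1 + n ^ 2) + lam₂ * M * n ^ 2 + (lam₁ + lam₂ * M) := by
            linarith
          _ = A₁ * (1 + n ^ 2) := by rw [hA₁]; ring
      have h3 : 0 ≤ lam₁ * n ^ 2 := by positivity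
      rw [abs_le]
      constructor <;> linarith
    have hD2 : D ≤ A₂ * (1 + n ^ 2) := by
      refine hDle.trans ?_
      have p1 : (n + B) ^ 2 ≤ 2 * ((1 + B ^ 2) * (1 + n ^ 2)) := by
        have q1 := add_sq_le (a := n) (b := B)
        have q2 : 0 ≤ n ^ 2 * B ^ 2 := by positivity
        calc (n + B) ^ 2 ≤ 2 * (n ^ 2 + B ^ 2) := q1
          _ ≤ 2 * (n ^ 2 + B ^ 2) + 2 * (1 + n ^ 2 * B ^ 2) := by linarith
          _ = _ := by ring
      have p2 := mul_le_mul_of_nonneg_left p1 (by positivity : 0 ≤ σ₁ ^ 2 / 2)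
      have p3 : 0 ≤ σ₂ ^ 2 / 2 * M ^ 2 := by positivity
      calc _ ≤ σ₁ ^ 2 / 2 * (2 * ((1 + B ^ 2) * (1 + n ^ 2))) + σ₂ ^ 2 / 2 * M ^ 2 * n ^ 2 +
            σ₂ ^ 2 / 2 * M ^ 2 := by linarith
        _ = A₂ * (1 + n ^ 2) := by rw [hA₂]; ring
    have t1 : 2 * c₁ * β ≤ 2 * (G * (A₁ * (1 + n ^ 2))) := by
      have : c₁ * β ≤ |c₁| * |β| := by rw [← abs_mul]; exact le_abs_self _
      have := mul_le_mul hG1 hβabs (abs_nonneg _) hG0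
      linarith
    have t2 : 4 * (c₂ * (1 / N)) * n ^ 2 + 2 * d * c₁ ≤ 4 * G + 2 * d * G := by
      have e : c₂ * (1 / N) * n ^ 2 = n ^ 2 / N * c₂ := by ring
      have q1 := (le_abs_self _).trans hG2
      have q2 := mul_le_mul_of_nonneg_left ((le_abs_self _).trans hG1)
        (by positivity : (0 : ℝ) ≤ 2 * d)
      rw [← e] at q1
      linarith
    have t3 : D * (4 * (c₂ * (1 / N)) * n ^ 2 + 2 * d * c₁) ≤
        A₂ * (1 + n ^ 2) * (4 * G + 2 * d * G) :=
      (mul_le_mul_of_nonneg_left t2 hD0).trans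
        (mul_le_mul_of_nonneg_right hD2 (by positivity))
    -- In the far region `n² / N ≥ 1`, so quadratic growth is traded for quartic growth with a
    -- factor `1 / N`.
    have t4 : A * (1 + n ^ 2) ≤ 2 * A / N * (1 + n ^ 4) := by
      calc A * (1 + n ^ 2) ≤ A * (1 + n ^ 2) * (n ^ 2 / N) :=
            le_mul_of_one_le_right (by positivity) hv
        _ = A / N * (n ^ 2 + n ^ 4) := by ring
        _ ≤ A / N * (2 * (1 + n ^ 4)) := by
            gcongr
            linarith [two_mul_le_add_sq (n ^ 2) 1, pow_nonneg hn0 4,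
              (by ring : (n ^ 2) ^ 2 = n ^ 4)]
        _ = _ := by ring
    have t5 : (1 - τ / 2) * δ * (n ^ 2 / 2) ≤ δ * (1 + n ^ 2) := by
      have h3 : (1 - τ / 2) * δ ≤ δ := mul_le_of_le_one_left hδ0.le (by linarith)
      have h4 : n ^ 2 / 2 ≤ 1 + n ^ 2 := by linarith [sq_nonneg n]
      exact mul_le_mul h3 h4 (by positivity) hδ0.le
    have t6 : A * (1 + n ^ 2) = 2 * (G * (A₁ * (1 + n ^ 2))) +
        A₂ * (1 + n ^ 2) * (4 * G + 2 * d * G) + δ * (1 + n ^ 2) := by rw [hA]; ring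
    have t7 : 0 ≤ K * B ^ 2 := by positivity
    linarith

end Variance

end Dissipation

/-! ### Integrated estimates for the generator, the variance and the mixture -/

section Integrability

variable {L : E d → ℝ} {ML CL Mg Cg : ℝ}

theorem LossRegular.integrable_generator_ballBump (hL : LossRegular L ML CL Mg Cg)
    (lam₁ lam₂ σ₁ σ₂ : ℝ) (m c : E d) {r : ℝ} (hr : 0 < r) (μ : ProbabilityMeasure (E d)) :
    Integrable (generator L lam₁ lam₂ σ₁ σ₂ m (ballBump c r)) (μ : Measure (E d)) := by
  refine Continuous.integrable_of_hasCompactSupport ?_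
    (hasCompactSupport_generator (hasCompactSupport_ballBump c hr) _ _ _ _ _ _)
  refine hL.continuous_generator_radial (hasDerivAt_bumpProfile r)
    (hasDerivAt_bumpProfile_deriv r) ?_ lam₁ lam₂ σ₁ σ₂ m c
  exact continuous_const.mul (continuous_expNegInvGlue_second.comp (by fun_prop))

theorem LossRegular.integrable_generator_truncSq (hL : LossRegular L ML CL Mg Cg)
    (lam₁ lam₂ σ₁ σ₂ : ℝ) (m c : E d) {N : ℝ} (hN : 0 < N) (μ : ProbabilityMeasure (E d)) :
    Integrable (generator L lam₁ lam₂ σ₁ σ₂ m (truncSq c N)) (μ : Measure (E d)) := by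
  refine Continuous.integrable_of_hasCompactSupport ?_
    (hasCompactSupport_generator (hasCompactSupport_truncSq c hN) _ _ _ _ _ _)
  refine hL.continuous_generator_radial (hasDerivAt_truncProfile hN)
    (hasDerivAt_truncProfile_deriv N) ?_ lam₁ lam₂ σ₁ σ₂ m c
  exact (continuous_deriv_deriv_cutoff.comp (by fun_prop)).mul continuous_const

theorem integrable_truncSq (c : E d) {N : ℝ} (hN : 0 < N) (μ : ProbabilityMeasure (E d)) :
    Integrable (truncSq c N) (μ : Measure (E d)) :=
  (contDiff_truncSq c N).continuous.integrable_of_hasCompactSupport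
    (hasCompactSupport_truncSq c hN)

theorem variance_nonneg (θ : E d) (μ : ProbabilityMeasure (E d)) : 0 ≤ variance θ μ :=
  mul_nonneg (by norm_num) (integral_nonneg fun x => by positivity)

theorem variance_eq (θ : E d) (μ : ProbabilityMeasure (E d)) :
    variance θ μ = ∫ x, ‖x - θ‖ ^ 2 / 2 ∂(μ : Measure (E d)) := by
  rw [variance, integral_div]
  ring

theorem integral_truncSq_le {μ : ProbabilityMeasure (E d)} (hμ : MemP4 μ) (θ : E d) {N : ℝ}
    (hN : 0 < N) : ∫ x, truncSq θ N x ∂(μ : Measure (E d)) ≤ variance θ μ := by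
  rw [variance_eq]
  exact integral_mono (integrable_truncSq θ hN μ) ((hμ.integrable_sq θ).div_const 2)
    fun x => truncSq_le θ hN x

theorem variance_le_integral_truncSq_add {μ : ProbabilityMeasure (E d)} (hμ : MemP4 μ) (θ : E d)
    {N : ℝ} (hN : 0 < N) : variance θ μ ≤ ∫ x, truncSq θ N x ∂(μ : Measure (E d)) +
      (∫ x, ‖x - θ‖ ^ 4 ∂(μ : Measure (E d))) / N := by
  have h1 := integrable_truncSq θ hN μ
  have h2 := (hμ.integrable_sub_pow θ).div_const N
  rw [variance_eq, ← integral_div, ← integral_add h1 h2]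
  exact integral_mono ((hμ.integrable_sq θ).div_const 2) (h1.add h2)
    fun x => le_truncSq_add θ hN x

theorem integral_generator_le {μ : ProbabilityMeasure (E d)} (hμ : MemP4 μ) {θ : E d}
    {g : E d → ℝ} (hg : Integrable g (μ : Measure (E d))) {a b c C₄ : ℝ} (hc : 0 ≤ c)
    (hC₄ : ∫ x, ‖x - θ‖ ^ 4 ∂(μ : Measure (E d)) ≤ C₄)
    (hle : ∀ x, g x ≤ -a * (‖x - θ‖ ^ 2 / 2) + b + c * (1 + ‖x - θ‖ ^ 4)) :
    ∫ x, g x ∂(μ : Measure (E d)) ≤ -a * variance θ μ + b + c * (1 + C₄) := by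
  have h2 := ((hμ.integrable_sq θ).div_const 2).const_mul (-a)
  have h4 := hμ.integrable_sub_pow θ
  have h5 : Integrable (fun x => c * (1 + ‖x - θ‖ ^ 4)) (μ : Measure (E d)) :=
    ((integrable_const (1 : ℝ)).add h4).const_mul c
  have h3 : Integrable (fun x => -a * (‖x - θ‖ ^ 2 / 2) + b) (μ : Measure (E d)) :=
    h2.add (integrable_const b)
  refine (integral_mono hg (h3.add h5) hle).trans ?_
  have e1 : ∫ x, (-a * (‖x - θ‖ ^ 2 / 2) + b + c * (1 + ‖x - θ‖ ^ 4)) ∂(μ : Measure (E d)) =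
      -a * variance θ μ + b + c * (1 + ∫ x, ‖x - θ‖ ^ 4 ∂(μ : Measure (E d))) := by
    rw [integral_add h3 h5, integral_add h2 (integrable_const b), integral_const_mul, integral_const_mul, integral_add (integrable_const 1) h4, variance_eq]
    simp
  refine e1.trans_le ?_
  gcongr

/-- Each class has its variance around its own minimizer, while the mixture is seen from one of
them; the distance between the minimizers pays for the change of center. -/
theorem integral_norm_sub_mixture_le {w : Fin 2 → ℝ≥0} (hw : w 0 + w 1 = 1)
    {μ : Fin 2 → ProbabilityMeasure (E d)} (hμ : ∀ k, MemP4 (μ k)) (θ : Fin 2 → E d)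
    (k : Fin 2) : ∫ x, ‖x - θ k‖ ∂(mixture w μ) ≤
      1 + totalVariance θ μ + ‖θ 0 - θ 1‖ := by
  have hj : ∀ j, ∫ x, ‖x - θ k‖ ∂(μ j : Measure (E d)) ≤
      1 + totalVariance θ μ + ‖θ 0 - θ 1‖ := by
    intro j
    have hjk : ‖θ j - θ k‖ ≤ ‖θ 0 - θ 1‖ := by
      fin_cases j <;> fin_cases k <;> simp [norm_sub_rev (θ 1) (θ 0)]
    have hV : variance (θ j) (μ j) ≤ totalVariance θ μ := by
      have h0 := variance_nonneg (θ 0) (μ 0)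
      have h1 := variance_nonneg (θ 1) (μ 1)
      rw [totalVariance]
      fin_cases j <;> simp [h0, h1]
    have h2 := ((hμ j).integrable_sq (θ j)).div_const 2
    have h3 := h2.add (integrable_const (μ := (μ j : Measure (E d))) (1 + ‖θ 0 - θ 1‖))
    calc ∫ x, ‖x - θ k‖ ∂(μ j : Measure (E d))
        ≤ ∫ x, (‖x - θ j‖ ^ 2 / 2 + (1 + ‖θ 0 - θ 1‖)) ∂(μ j : Measure (E d)) := by
          refine integral_mono ((hμ j).integrable_norm_sub (θ k)) h3 fun x => ?_
          have h4 := norm_sub_le_norm_sub_add_norm_sub x (θ j) (θ k)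
          nlinarith [sq_nonneg (‖x - θ j‖ - 1)]
      _ = variance (θ j) (μ j) + (1 + ‖θ 0 - θ 1‖) := by
          rw [integral_add h2 (integrable_const _), variance_eq]
          simp
      _ ≤ _ := by linarith
  rw [integral_mixture fun j => (hμ j).integrable_norm_sub (θ k), smul_eq_mul, smul_eq_mul]
  have hw' : (w 0 : ℝ) + w 1 = 1 := by exact_mod_cast hw
  calc _ ≤ (w 0 : ℝ) * (1 + totalVariance θ μ + ‖θ 0 - θ 1‖) +
        w 1 * (1 + totalVariance θ μ + ‖θ 0 - θ 1‖) :=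
      add_le_add (mul_le_mul_of_nonneg_left (hj 0) (w 0).2)
        (mul_le_mul_of_nonneg_left (hj 1) (w 1).2)
    _ = _ := by rw [← add_mul, hw', one_mul]

theorem le_real_mixture (w : Fin 2 → ℝ≥0) (μ : Fin 2 → ProbabilityMeasure (E d)) (k : Fin 2)
    (s : Set (E d)) : w k * (μ k : Measure (E d)).real s ≤ (mixture w μ).real s := by
  have h0 : 0 ≤ (w 0 : ℝ) * (μ 0 : Measure (E d)).real s := by positivity
  have h1 : 0 ≤ (w 1 : ℝ) * (μ 1 : Measure (E d)).real s := by positivity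
  rw [mixture, measureReal_add_apply, measureReal_nnreal_smul_apply,
    measureReal_nnreal_smul_apply]
  fin_cases k
  · simpa using h1
  · simpa using h0

end Integrability

/-! ### Sublevel sets near the minimizer -/

section Coercive

theorem LossCoercive.exists_radius {L : E d → ℝ} {θ : E d} (hL : LossCoercive L θ)
    (hbdd : ∀ x, ⨅ z, L z ≤ L x) {R : ℝ} (hR : 0 < R) :
    ∃ q r : ℝ, 0 < q ∧ 0 < r ∧ (∀ x, L x - (⨅ z, L z) ≤ 2 * q → ‖x - θ‖ ≤ R) ∧
      ∀ x ∈ Metric.ball θ r, L x - (⨅ z, L z) ≤ q := by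
  obtain ⟨Linf, R₀, η, ν, hLinf, hR₀, hη, hν, -, hnear, hfar⟩ := hL.coercive
  -- Levels up to `Linf` force `x` into the coercivity ball; levels up to `(ηR)^(1/ν)` turn the
  -- coercivity bound into `R`. The result is used with `2q = Q`.
  set Q : ℝ := min Linf ((η * R) ^ ν⁻¹) with hQ
  have hQ0 : 0 < Q := lt_min hLinf (by positivity)
  have hnhds : ∀ᶠ x in 𝓝 θ, L x < L θ + Q / 2 :=
    hL.continuous.continuousAt.eventually (gt_mem_nhds (by linarith))
  obtain ⟨r, hr, hball⟩ := Metric.eventually_nhds_iff_ball.1 hnhds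
  refine ⟨Q / 2, r, by positivity, hr, fun x hx => ?_, fun x hx => ?_⟩
  · have hx' : L x - (⨅ z, L z) ≤ Q := by linarith
    have hmem : x ∈ Metric.ball θ R₀ := by
      by_contra hcon
      exact absurd (hfar x hcon) (not_lt.2 (hx'.trans (min_le_left _ _)))
    have h1 : (L x - ⨅ z, L z) ^ ν ≤ η * R := by
      calc (L x - ⨅ z, L z) ^ ν ≤ ((η * R) ^ ν⁻¹) ^ ν :=
            Real.rpow_le_rpow (sub_nonneg.2 (hbdd x)) (hx'.trans (min_le_right _ _)) hν.le
        _ = η * R := Real.rpow_inv_rpow (by positivity) hν.ne'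
    calc ‖x - θ‖ ≤ 1 / η * (L x - ⨅ z, L z) ^ ν := hnear x hmem
      _ ≤ 1 / η * (η * R) := by gcongr
      _ = R := by field_simp
  · have := hball x hx
    rw [hL.isMin] at this
    linarith

end Coercive

/-! ### A priori estimates for weak solutions and the first-exit-time argument -/

section Solution

variable {L : Fin 2 → E d → ℝ} {w : Fin 2 → ℝ≥0} {α lam₁ lam₂ σ₁ σ₂ T : ℝ}
  {ρ₀ : Fin 2 → ProbabilityMeasure (E d)} {ρ : Fin 2 → ℝ → ProbabilityMeasure (E d)}
  {θs : Fin 2 → E d} {ML CL Mg Cg : Fin 2 → ℝ}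

theorem continuousOn_totalVariance (hρ : ∀ k, IsContinuousP4 T (ρ k)) (θs : Fin 2 → E d) :
    ContinuousOn (fun s => totalVariance θs fun k => ρ k s) (Icc 0 T) :=
  (((linGrowthLipschitz_norm_sub_sq (θs 0)).continuousOn_integral (hρ 0)).const_mul _ |>.add
    (((linGrowthLipschitz_norm_sub_sq (θs 1)).continuousOn_integral (hρ 1)).const_mul _))

/-- Lower bound on the mass that a weak solution puts on a ball. -/
theorem IsWeakSolution.integral_ballBump_ge
    (hsol : IsWeakSolution L w α lam₁ lam₂ σ₁ σ₂ T ρ₀ ρ)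
    (hL : ∀ k, LossRegular (L k) (ML k) (CL k) (Mg k) (Cg k)) (k : Fin 2) {c : E d} {r p t : ℝ}
    (hr : 0 < r) (hp : 0 < p) (ht : t ∈ Icc 0 T)
    (hgen : ∀ s ∈ Ioo 0 t, ∀ x, -p * ballBump c r x ≤ generator (L k) lam₁ lam₂ σ₁ σ₂
      (consensus (L k) α (mixture w fun j => ρ j s)) (ballBump c r) x) :
    (∫ x, ballBump c r x ∂(ρ k 0 : Measure (E d))) * Real.exp (-(p * t)) ≤
      ∫ x, ballBump c r x ∂(ρ k t : Measure (E d)) := by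
  have h1 := contDiff_ballBump c r
  have h2 := hasCompactSupport_ballBump c hr
  have hc := ((linGrowthLipschitz_of_hasCompactSupport h1 h2).continuousOn_integral
    (hsol.continuous k)).mono (Icc_subset_Icc_right ht.2)
  have := le_exp_of_deriv_le (e := 0) ht.1 hp le_rfl hc.neg
    (fun s hs => (hsol.hasDerivAt k _ h1 h2 s ⟨hs.1, hs.2.trans_le ht.2⟩).neg) fun s hs => ?_
  · simp only [Pi.neg_apply, zero_div, add_zero] at this
    linarith
  · have h3 := integral_mono ((integrable_ballBump c hr (ρ k s : Measure (E d))).const_mul (-p))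
      ((hL k).integrable_generator_ballBump lam₁ lam₂ σ₁ σ₂
        (consensus (L k) α (mixture w fun j => ρ j s)) c hr (ρ k s)) (hgen s hs)
    rw [integral_const_mul] at h3
    simp only [Pi.neg_apply]
    linarith

/-- Exponential decay of the total variance as long as the consensus points stay close to the
minimizers. -/
theorem IsWeakSolution.totalVariance_le
    (hsol : IsWeakSolution L w α lam₁ lam₂ σ₁ σ₂ T ρ₀ ρ)
    (hL : ∀ k, LossRegular (L k) (ML k) (CL k) (Mg k) (Cg k))
    (hθ : ∀ k, L k (θs k) = ⨅ z, L k z) {M δ τ ε B t : ℝ} (hM : ∀ k, Mg k ≤ M)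
    (hlam₁ : 0 < lam₁) (hlam₂ : 0 < lam₂) (hδ : δ = rate d lam₁ lam₂ σ₁ σ₂ M) (hδ0 : 0 < δ)
    (hτ : τ ∈ Ioo (0 : ℝ) 1) (hB : 0 ≤ B)
    (hBε : 2 * (((lam₁ + d * σ₁ ^ 2) ^ 2 / (τ * δ) + d * σ₁ ^ 2 / 2) * B ^ 2) ≤ τ / 2 * δ * ε)
    (ht : t ∈ Icc 0 T)
    (hm : ∀ k, ∀ s ∈ Ioo 0 t, ‖consensus (L k) α (mixture w fun j => ρ j s) - θs k‖ ≤ B)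
    (hV : ∀ s ∈ Ioo 0 t, ε ≤ totalVariance θs fun k => ρ k s) :
    totalVariance θs (fun k => ρ k t) ≤
      totalVariance θs (fun k => ρ k 0) * Real.exp (-((1 - τ) * δ * t)) := by
  have hκ : 0 < (1 - τ) * δ := mul_pos (by linarith [hτ.2]) hδ0
  set κ : ℝ := (1 - τ) * δ with hκdef
  set KB := ((lam₁ + d * σ₁ ^ 2) ^ 2 / (τ * δ) + d * σ₁ ^ 2 / 2) * B ^ 2
  choose C hC0 hC using fun k => (hL k).exists_generator_truncSq_le (σ₁ := σ₁) (σ₂ := σ₂)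
    hlam₁ hlam₂ (hθ k) (hM k) hδ hδ0 hτ hB
  choose C₄ hC₄ using fun k => (hsol.continuous k).exists_moment_bound (θs k)
  have h0T : (0 : ℝ) ∈ Icc 0 T := ⟨le_rfl, ht.1.trans ht.2⟩
  have hC₄0 : ∀ k, 0 ≤ C₄ k := fun k =>
    (integral_nonneg fun x => by positivity).trans (hC₄ k 0 h0T)
  set e : ℝ := C 0 * (1 + C₄ 0) + C 1 * (1 + C₄ 1) with he
  have he0 : 0 ≤ e := by
    have := hC0 0; have := hC0 1; have := hC₄0 0; have := hC₄0 1
    positivity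
  -- The constants `e` and `C₄` do not depend on `N`, so the truncation error disappears as `N → ∞`.
  have key : ∀ N : ℝ, 0 < N → totalVariance θs (fun k => ρ k t) ≤
      totalVariance θs (fun k => ρ k 0) * Real.exp (-(κ * t)) +
        (e / κ + (C₄ 0 + C₄ 1)) / N := by
    intro N hN
    have hcont : ∀ k, ContinuousOn (fun s => ∫ x, truncSq (θs k) N x ∂(ρ k s : Measure (E d)))
        (Icc 0 t) := fun k =>
      ((linGrowthLipschitz_of_hasCompactSupport (contDiff_truncSq (θs k) N)
        (hasCompactSupport_truncSq (θs k) hN)).continuousOn_integral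
          (hsol.continuous k)).mono (Icc_subset_Icc_right ht.2)
    have hmem : ∀ k, ∀ s ∈ Icc 0 T, MemP4 (ρ k s) := fun k => (hsol.continuous k).memP4
    have hder := fun (k : Fin 2) (s : ℝ) (hs : s ∈ Ioo 0 t) =>
      hsol.hasDerivAt k _ (contDiff_truncSq (θs k) N) (hasCompactSupport_truncSq (θs k) hN) s
        ⟨hs.1, hs.2.trans_le ht.2⟩
    have hgron := le_exp_of_deriv_le (e := e / N) ht.1 hκ (by positivity)
      ((hcont 0).add (hcont 1)) (fun s hs => (hder 0 s hs).add (hder 1 s hs)) fun s hs => ?_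
    · simp only [Pi.add_apply] at hgron
      have htr : ∀ k, variance (θs k) (ρ k t) ≤
          ∫ x, truncSq (θs k) N x ∂(ρ k t : Measure (E d)) + C₄ k / N := fun k =>
        (variance_le_integral_truncSq_add (hmem k t ht) (θs k) hN).trans
          (by gcongr; exact hC₄ k t ht)
      have h0 := integral_truncSq_le (hmem 0 0 h0T) (θs 0) hN
      have h1 := integral_truncSq_le (hmem 1 0 h0T) (θs 1) hN
      have h2 := mul_le_mul_of_nonneg_right (add_le_add h0 h1) (Real.exp_pos (-(κ * t))).le
      have h3 : (e / κ + (C₄ 0 + C₄ 1)) / N = e / N / κ + C₄ 0 / N + C₄ 1 / N := by ring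
      rw [h3, totalVariance, totalVariance]
      linarith [htr 0, htr 1]
    · have hsT : s ∈ Icc 0 T := ⟨hs.1.le, hs.2.le.trans ht.2⟩
      have hint : ∀ k, ∫ x, generator (L k) lam₁ lam₂ σ₁ σ₂
          (consensus (L k) α (mixture w fun j => ρ j s)) (truncSq (θs k) N) x
            ∂(ρ k s : Measure (E d)) ≤
          -((1 - τ / 2) * δ) * variance (θs k) (ρ k s) + KB + C k / N * (1 + C₄ k) := fun k =>
        integral_generator_le (hmem k s hsT)
          ((hL k).integrable_generator_truncSq _ _ _ _ _ _ hN _) (div_nonneg (hC0 k) hN.le)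
          (hC₄ k s hsT) (hC k N hN _ (hm k s hs))
      -- Grönwall runs on the truncated integrals. They lie below the variances, so `-κ` times the
      -- total variance may be replaced by `-κ` times their sum.
      have h0 := integral_truncSq_le (hmem 0 s hsT) (θs 0) hN
      have h1 := integral_truncSq_le (hmem 1 s hsT) (θs 1) hN
      have h2 := mul_le_mul_of_nonneg_left (add_le_add h0 h1) hκ.le
      -- Since the total variance is at least `ε`, the remaining dissipation `τ/2 · δ` covers the
      -- two errors `KB`, one per class.
      have h3 := mul_le_mul_of_nonneg_left (hV s hs)
        (mul_nonneg (half_pos hτ.1).le hδ0.le : 0 ≤ τ / 2 * δ)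
      have h4 : e / N = C 0 / N * (1 + C₄ 0) + C 1 / N * (1 + C₄ 1) := by rw [he]; ring
      simp only [totalVariance] at h3
      have h5 : -((1 - τ / 2) * δ) * (variance (θs 0) (ρ 0 s) + variance (θs 1) (ρ 1 s)) +
          τ / 2 * δ * (variance (θs 0) (ρ 0 s) + variance (θs 1) (ρ 1 s)) =
          -κ * (variance (θs 0) (ρ 0 s) + variance (θs 1) (ρ 1 s)) := by rw [hκdef]; ring
      rw [h4]
      simp only [Pi.add_apply]
      linarith [hint 0, hint 1]
  have hlim : Tendsto (fun N : ℝ => totalVariance θs (fun k => ρ k 0) * Real.exp (-(κ * t)) +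
      (e / κ + (C₄ 0 + C₄ 1)) / N) atTop
      (𝓝 (totalVariance θs (fun k => ρ k 0) * Real.exp (-(κ * t)) + 0)) :=
    tendsto_const_nhds.add (tendsto_const_nhds.div_atTop tendsto_id)
  rw [add_zero] at hlim
  exact ge_of_tendsto hlim ((eventually_gt_atTop 0).mono key)

theorem rate_pos {M : ℝ}
    (h : 2 * lam₁ > 2 * lam₂ * M + d * σ₁ ^ 2 + d * σ₂ ^ 2 * M ^ 2) :
    0 < rate d lam₁ lam₂ σ₁ σ₂ M := by
  rw [rate]; linarith

/-- For large `α` the consensus points of every weak solution stay close to the minimizers as long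
as the total variance exceeds `ε`. -/
theorem exists_consensus_close
    (hL₁ : ∀ k, LossRegular (L k) (ML k) (CL k) (Mg k) (Cg k))
    (hL₂ : ∀ k, LossCoercive (L k) (θs k)) (hw : ∀ k, 0 < w k) (hw_sum : w 0 + w 1 = 1)
    (hρ₀_pos : ∀ k, ∀ r : ℝ, 0 < r → 0 < (ρ₀ k : Measure (E d)) (Metric.ball (θs k) r))
    {M δ τ ε B : ℝ} (hM : ∀ k, Mg k ≤ M) (hlam₁ : 0 < lam₁) (hlam₂ : 0 < lam₂) (hσ₁ : 0 < σ₁)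
    (hσ₂ : 0 < σ₂) (hδ : δ = rate d lam₁ lam₂ σ₁ σ₂ M) (hδ0 : 0 < δ)
    (hτ : τ ∈ Ioo (0 : ℝ) 1) (hB : 0 < B)
    (hBε : 2 * (((lam₁ + d * σ₁ ^ 2) ^ 2 / (τ * δ) + d * σ₁ ^ 2 / 2) * B ^ 2) ≤ τ / 2 * δ * ε)
    (hT : 0 < T) :
    ∃ α₀ : ℝ, 0 < α₀ ∧ ∀ α : ℝ, α₀ < α → ∀ ρ : Fin 2 → ℝ → ProbabilityMeasure (E d),
      IsWeakSolution L w α lam₁ lam₂ σ₁ σ₂ T ρ₀ ρ → ∀ t ∈ Icc 0 T,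
      (∀ s ∈ Ico 0 t, ε < totalVariance θs fun k => ρ k s) →
      ∀ k, ∀ s ∈ Icc 0 t, ‖consensus (L k) α (mixture w fun j => ρ j s) - θs k‖ < B := by
  -- One half of `B` goes to the radius of the sublevel set, the other to the Laplace tail.
  choose q r hq hr hR hball using fun k =>
    (hL₂ k).exists_radius (hL₁ k).iInf_le (half_pos hB)
  choose p hp hgen using fun k => (hL₁ k).exists_generator_ballBump_ge (lam₂ := lam₂) hlam₁
    hσ₁ hσ₂ (θs k) B (hr k)
  set b : Fin 2 → ℝ := fun k =>
    w k * ((∫ x, ballBump (θs k) (r k) x ∂(ρ₀ k : Measure (E d))) * Real.exp (-(p k * T)))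
  have hb : ∀ k, 0 < b k := fun k => mul_pos (hw k)
    (mul_pos (integral_ballBump_pos _ (hr k) _ (hρ₀_pos k _ (hr k))) (Real.exp_pos _))
  set J : ℝ := 1 + totalVariance θs ρ₀ + ‖θs 0 - θs 1‖ with hJ
  -- `b` and `J` involve only the initial data, `B` and the horizon, so the threshold for `α` is
  -- independent of the solution.
  have hev : ∀ k, ∀ᶠ α : ℝ in atTop, Real.exp (-(α * q k)) / b k * J < B / 2 := by
    intro k
    have h1 : Tendsto (fun α : ℝ => Real.exp (-(α * q k)) / b k * J) atTop (𝓝 (0 / b k * J)) :=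
      ((Real.tendsto_exp_neg_atTop_nhds_zero.comp
        (tendsto_id.atTop_mul_const (hq k))).div_const _).mul_const _
    rw [zero_div, zero_mul] at h1
    exact h1.eventually (gt_mem_nhds (half_pos hB))
  obtain ⟨a, ha⟩ := eventually_atTop.1 ((hev 0).and (hev 1))
  refine ⟨max a 1, by positivity, fun α hα ρ hsol t ht hV => ?_⟩
  have hα0 : 0 ≤ α := (zero_le_one.trans (le_max_right a 1)).trans hα.le
  have hαk : ∀ k, Real.exp (-(α * q k)) / b k * J < B / 2 := by
    have := ha α ((le_max_left a 1).trans hα.le)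
    intro k
    fin_cases k
    · exact this.1
    · exact this.2
  have hinit : ∀ k, ρ k 0 = ρ₀ k := fun k => (hsol.continuous k).eq_of_tendsto hT (hsol.initial k)
  -- The self-improving step: a weak bound strictly before `u` gives a strict one at `u`. At `u = 0`
  -- its premise is vacuous, so it also starts the argument.
  have hstep : ∀ u ∈ Icc 0 t,
      (∀ k, ∀ s ∈ Ioo 0 u, ‖consensus (L k) α (mixture w fun j => ρ j s) - θs k‖ ≤ B) →
      ∀ k, ‖consensus (L k) α (mixture w fun j => ρ j u) - θs k‖ < B := by
    intro u hu hm k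
    have huT : u ∈ Icc 0 T := ⟨hu.1, hu.2.trans ht.2⟩
    have hmem : ∀ j, MemP4 (ρ j u) := fun j => (hsol.continuous j).memP4 u huT
    have hVu : totalVariance θs (fun k => ρ k u) ≤ totalVariance θs ρ₀ := by
      have h1 := hsol.totalVariance_le hL₁ (fun k => (hL₂ k).isMin) hM hlam₁ hlam₂ hδ hδ0 hτ hB.le
        hBε huT hm fun s hs => (hV s ⟨hs.1.le, hs.2.trans_le hu.2⟩).le
      simp only [hinit] at h1
      refine h1.trans (mul_le_of_le_one_right
        (add_nonneg (variance_nonneg _ _) (variance_nonneg _ _)) (Real.exp_le_one_iff.2 ?_))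
      exact neg_nonpos.2 (mul_nonneg (mul_pos (by linarith [hτ.2]) hδ0).le hu.1)
    have hmass : b k ≤ (mixture w fun j => ρ j u).real (Metric.ball (θs k) (r k)) := by
      refine le_trans ?_ (le_real_mixture w (fun j => ρ j u) k _)
      refine mul_le_mul_of_nonneg_left ?_ (w k).2
      have h1 := hsol.integral_ballBump_ge hL₁ k (hr k) (hp k) huT
        fun s hs => hgen k _ (hm k s hs)
      rw [hinit] at h1
      refine le_trans ?_ (h1.trans (integral_ballBump_le (θs k) (hr k) (ρ k u : Measure (E d))))
      refine mul_le_mul_of_nonneg_left (Real.exp_le_exp.2 ?_)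
        (integral_nonneg fun x => ballBump_nonneg _ _ _)
      exact neg_le_neg (mul_le_mul_of_nonneg_left huT.2 (hp k).le)
    have := isProbabilityMeasure_mixture hw_sum fun j => ρ j u
    have hlap := norm_consensus_sub_le hα0 (hR k) (hball k) ((hb k).trans_le hmass)
      (integrable_mixture fun j => (hmem j).integrable_norm_sub (θs k))
      (integrable_mixture fun j => ((hL₁ k).linGrowthLipschitz_exp hα0).integrable (hmem j))
      (integrable_mixture fun j =>
        ((hL₁ k).linGrowthLipschitz_exp_smul hα0).integrable (hmem j)) (half_pos hB).le
    have hJle : ∫ x, ‖x - θs k‖ ∂(mixture w fun j => ρ j u) ≤ J :=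
      (integral_norm_sub_mixture_le hw_sum hmem θs k).trans (by rw [hJ]; linarith)
    have hprod : Real.exp (-(α * q k)) /
        (mixture w fun j => ρ j u).real (Metric.ball (θs k) (r k)) *
          ∫ x, ‖x - θs k‖ ∂(mixture w fun j => ρ j u) ≤ Real.exp (-(α * q k)) / b k * J := by
      refine mul_le_mul ?_ hJle (integral_nonneg fun x => norm_nonneg _)
        (div_nonneg (Real.exp_pos _).le (hb k).le)
      exact div_le_div_of_nonneg_left (Real.exp_pos _).le (hb k) hmass
    linarith [hαk k]
  -- there is no first time at which some consensus point has distance `B`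
  set bad : Set ℝ := ⋃ k, Icc 0 t ∩
    (fun s => ‖consensus (L k) α (mixture w fun j => ρ j s) - θs k‖) ⁻¹' Ici B with hbad
  have hclosed : IsClosed bad := isClosed_iUnion_of_finite fun k =>
    (((((hL₁ k).continuousOn_consensus hα0 hw_sum hsol.continuous).mono
      (Icc_subset_Icc_right ht.2)).sub continuousOn_const).norm).preimage_isClosed_of_isClosed
        isClosed_Icc isClosed_Ici
  have hsub : bad ⊆ Icc 0 t := iUnion_subset fun k => inter_subset_left
  have hempty : bad = ∅ := by
    by_contra hne
    obtain ⟨u, hu, hmin⟩ := (isCompact_Icc.of_isClosed_subset hclosed hsub).exists_isLeast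
      (nonempty_iff_ne_empty.2 hne)
    have hut := hsub hu
    obtain ⟨k, -, hk⟩ := mem_iUnion.1 hu
    refine absurd (hstep u hut (fun j s hs => ?_) k) (not_lt.2 hk)
    by_contra hcon
    have : s ∈ bad := mem_iUnion.2
      ⟨j, ⟨hs.1.le, hs.2.le.trans hut.2⟩, (not_le.1 hcon).le⟩
    exact absurd (hmin this) (not_le.2 hs.2)
  intro k s hs
  by_contra hcon
  have : s ∈ bad := mem_iUnion.2 ⟨k, hs, not_lt.1 hcon⟩
  rw [hempty] at this
  exact this

end Solution

end FedCBO

/-! ### Conclusion -/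

theorem mainTheorem3 (d : ℕ) (L : Fin 2 → FedCBO.E d → ℝ) (θs : Fin 2 → FedCBO.E d)
    (ML CL Mg Cg : Fin 2 → ℝ)
    (hL₁ : ∀ k, FedCBO.LossRegular (L k) (ML k) (CL k) (Mg k) (Cg k))
    (hL₂ : ∀ k, FedCBO.LossCoercive (L k) (θs k))
    (w : Fin 2 → ℝ≥0) (hw : ∀ k, 0 < w k) (hw_sum : w 0 + w 1 = 1)
    (ρ₀ : Fin 2 → ProbabilityMeasure (FedCBO.E d)) (hρ₀ : ∀ k, FedCBO.MemP4 (ρ₀ k))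
    (hρ₀_pos : ∀ k, ∀ r : ℝ, 0 < r →
      0 < (ρ₀ k : Measure (FedCBO.E d)) (Metric.ball (θs k) r))
    (ε τ : ℝ) (hε : ε ∈ Ioo 0 (FedCBO.totalVariance θs ρ₀)) (hτ : τ ∈ Ioo (0 : ℝ) 1)
    (lam₁ lam₂ σ₁ σ₂ M Tstar : ℝ) (hlam₁ : 0 < lam₁) (hlam₂ : 0 < lam₂)
    (hσ₁ : 0 < σ₁) (hσ₂ : 0 < σ₂) (hM : M = max (Mg 0) (Mg 1))
    (hparam : 2 * lam₁ > 2 * lam₂ * M + d * σ₁ ^ 2 + d * σ₂ ^ 2 * M ^ 2)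
    (hT : Tstar = FedCBO.horizon d lam₁ lam₂ σ₁ σ₂ M τ (FedCBO.totalVariance θs ρ₀) ε) :
    ∃ α₀ : ℝ, 0 < α₀ ∧ ∀ α : ℝ, α₀ < α → ∀ ρ : Fin 2 → ℝ → ProbabilityMeasure (FedCBO.E d),
      FedCBO.IsWeakSolution L w α lam₁ lam₂ σ₁ σ₂ Tstar ρ₀ ρ →
      -- the minimum over `[0, T*]` is attained and is at most `ε`
      (∃ t ∈ Icc 0 Tstar,
        IsMinOn (fun s => FedCBO.totalVariance θs fun k => ρ k s) (Icc 0 Tstar) t ∧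
        FedCBO.totalVariance θs (fun k => ρ k t) ≤ ε) ∧
      -- exponential decay up to and including the first time at which `ε` is reached
      (∀ t ∈ Icc 0 Tstar, (∀ s ∈ Ico 0 t, ε < FedCBO.totalVariance θs fun k => ρ k s) →
        FedCBO.totalVariance θs (fun k => ρ k t) ≤ FedCBO.totalVariance θs ρ₀ *
          Real.exp (-((1 - τ) * FedCBO.rate d lam₁ lam₂ σ₁ σ₂ M * t))) := by
  have hδ0 : 0 < FedCBO.rate d lam₁ lam₂ σ₁ σ₂ M := FedCBO.rate_pos hparam
  set δ := FedCBO.rate d lam₁ lam₂ σ₁ σ₂ M with hδ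
  set V₀ := FedCBO.totalVariance θs ρ₀ with hV₀
  obtain ⟨hε0, hεV⟩ := hε
  have hV₀pos : 0 < V₀ := hε0.trans hεV
  have hκ : 0 < (1 - τ) * δ := mul_pos (by linarith [hτ.2]) hδ0
  have hTpos : 0 < Tstar := by
    rw [hT, FedCBO.horizon]
    exact mul_pos (one_div_pos.2 hκ) (Real.log_pos ((one_lt_div hε0).2 hεV))
  have hMk : ∀ k, Mg k ≤ M := by
    intro k
    rw [hM]
    fin_cases k
    · exact le_max_left _ _
    · exact le_max_right _ _
  obtain ⟨B, hB, hBε⟩ : ∃ B : ℝ, 0 < B ∧ 2 * (((lam₁ + d * σ₁ ^ 2) ^ 2 / (τ * δ) +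
      d * σ₁ ^ 2 / 2) * B ^ 2) ≤ τ / 2 * δ * ε := by
    have hτ0 := hτ.1
    have hK : 0 < (lam₁ + d * σ₁ ^ 2) ^ 2 / (τ * δ) + d * σ₁ ^ 2 / 2 := by positivity
    set K := (lam₁ + d * σ₁ ^ 2) ^ 2 / (τ * δ) + d * σ₁ ^ 2 / 2
    -- The largest admissible `B`: it solves `2 K B² = τ δ ε / 2`.
    refine ⟨√(τ * δ * ε / (4 * K)), by positivity, le_of_eq ?_⟩
    rw [Real.sq_sqrt (by positivity)]
    field_simp
    norm_num
  obtain ⟨α₀, hα₀, hclose⟩ := FedCBO.exists_consensus_close hL₁ hL₂ hw hw_sum hρ₀_pos hMk hlam₁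
    hlam₂ hσ₁ hσ₂ hδ hδ0 hτ hB hBε hTpos
  refine ⟨α₀, hα₀, fun α hα ρ hsol => ?_⟩
  have hdecay : ∀ t ∈ Icc 0 Tstar, (∀ s ∈ Ico 0 t, ε < FedCBO.totalVariance θs fun k => ρ k s) →
      FedCBO.totalVariance θs (fun k => ρ k t) ≤ V₀ * Real.exp (-((1 - τ) * δ * t)) := by
    intro t ht hV
    have h1 := hsol.totalVariance_le hL₁ (fun k => (hL₂ k).isMin) hMk hlam₁ hlam₂ hδ hδ0 hτ hB.le
      hBε ht (fun k s hs => (hclose α hα ρ hsol t ht hV k s ⟨hs.1.le, hs.2.le⟩).le)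
      fun s hs => (hV s ⟨hs.1.le, hs.2⟩).le
    have hinit : ∀ k, ρ k 0 = ρ₀ k := fun k =>
      (hsol.continuous k).eq_of_tendsto hTpos (hsol.initial k)
    simpa only [hinit] using h1
  refine ⟨?_, hdecay⟩
  obtain ⟨t, ht, hmin⟩ := isCompact_Icc.exists_isMinOn (nonempty_Icc.2 hTpos.le)
    (FedCBO.continuousOn_totalVariance hsol.continuous θs)
  refine ⟨t, ht, hmin, ?_⟩
  -- If the minimum exceeded `ε`, the decay estimate would hold up to `Tstar`, where by the choice
  -- of horizon its right-hand side equals `ε`.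
  by_contra! hcon
  have hTmem : Tstar ∈ Icc 0 Tstar := ⟨hTpos.le, le_rfl⟩
  have hfinal := hdecay Tstar hTmem fun s hs =>
    hcon.trans_le (hmin (show s ∈ Icc 0 Tstar from ⟨hs.1, hs.2.le⟩))
  have hexp : V₀ * Real.exp (-((1 - τ) * δ * Tstar)) = ε := by
    have : (1 - τ) * δ * Tstar = Real.log (V₀ / ε) := by
      rw [hT, FedCBO.horizon, ← hδ, ← mul_assoc, mul_one_div_cancel hκ.ne', one_mul]
    rw [this, Real.exp_neg, Real.exp_log (div_pos hV₀pos hε0), inv_div]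
    field_simp
  have hle : FedCBO.totalVariance θs (fun k => ρ k t) ≤
    FedCBO.totalVariance θs (fun k => ρ k Tstar) := hmin hTmem
  linarith
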